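/- Let $G$ be an [IN] group, i.e. a locally compact (Hausdorff) group whose identity has a compact neighbourhood that is invariant under all inner automorphisms, with left Haar measure $dx$. Let $A$ be a complex Banach algebra (not necessarily unital) with a bounded $\mathcal{Z}(A)$-approximate identity, i.e. a norm-bounded net $(a_\alpha)$ in $A$ such that $a_\alpha z \to z$ for every $z$ in the centre $\mathcal{Z}(A)$ of $A$. Let $L^1(G,A)$ be the Banach algebra of (classes of) Bochner integrable functions $f : G \to A$ with norm $\|f\| = \int_G \|f(x)\|\,dx$ and convolution $(f*g)(x) = \int_G f(xy)\,g(y^{-1})\,dy$, let $L^1(G) = L^1(G,\mathbb{C})$, let $\mathcal{Z}(B)$ denote the centre of an algebra $B$, and let $\otimes^\gamma$ denote the Banach space projective tensor product, with the product determined by $(b\otimes c)(b'\otimes c') = bb'\otimes cc'$. Then $$\mathcal{Z}\big(L^1(G,A)\big) \cong \mathcal{Z}(L^1(G)) \otimes^\gamma \mathcal{Z}(A)$$ isometrically as Banach algebras; more precisely, there is an isometric algebra isomorphism $\Phi$ of $\mathcal{Z}(L^1(G)) \otimes^\gamma \mathcal{Z}(A)$ onto $\mathcal{Z}(L^1(G,A))$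 with $\Phi(f \otimes z)(x) = f(x) z$ for almost every $x \in G$, for all $f \in \mathcal{Z}(L^1(G))$ and $z \in \mathcal{Z}(A)$. -/

import Mathlib

open MeasureTheory Filter Topology
open scoped TensorProduct ENNReal

/-- A non-unital subalgebra of a complex Banach algebra, with the restricted norm, is a normed
space. -/
instance NonUnitalSubalgebra.instNormedSpaceComplex {B : Type*} [NonUnitalNormedRing B]
    [NormedSpace ℂ B] (S : NonUnitalSubalgebra ℂ B) : NormedSpace ℂ S where
  norm_smul_le c x := norm_smul_le c (x : B)

/-! ### The projective tensor product of Banach spaces and of Banach algebras -/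

/-- The algebraic tensor product `E ⊗ F` over `ℂ`, as a carrier for the projective norm. -/
def AlgProj (E F : Type*) [SeminormedAddCommGroup E] [NormedSpace ℂ E]
    [SeminormedAddCommGroup F] [NormedSpace ℂ F] : Type _ := E ⊗[ℂ] F

namespace AlgProj

section Space

variable {E F : Type*} [SeminormedAddCommGroup E] [NormedSpace ℂ E]
  [SeminormedAddCommGroup F] [NormedSpace ℂ F]

noncomputable instance : AddCommGroup (AlgProj E F) :=
  inferInstanceAs (AddCommGroup (E ⊗[ℂ] F))

noncomputable instance : Module ℂ (AlgProj E F) :=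
  inferInstanceAs (Module ℂ (E ⊗[ℂ] F))

/-- The elementary tensor `x ⊗ y`. -/
noncomputable def tmul (x : E) (y : F) : AlgProj E F := (x ⊗ₜ[ℂ] y : E ⊗[ℂ] F)

/-- The possible values `∑ ‖xᵢ‖ ‖yᵢ‖` over all finite representations `u = ∑ xᵢ ⊗ yᵢ`. -/
def costs (u : AlgProj E F) : Set ℝ :=
  {r | ∃ l : List (E × F), (l.map fun p => tmul p.1 p.2).sum = u ∧
    (l.map fun p => ‖p.1‖ * ‖p.2‖).sum = r}

/-- The projective norm `‖u‖ = inf { ∑ ‖xᵢ‖ ‖yᵢ‖ : u = ∑ xᵢ ⊗ yᵢ }`. -/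
noncomputable instance : Norm (AlgProj E F) := ⟨fun u => sInf (costs u)⟩

theorem norm_def (u : AlgProj E F) : ‖u‖ = sInf (costs u) := rfl

theorem costs_nonneg {u : AlgProj E F} {r : ℝ} (hr : r ∈ costs u) : 0 ≤ r := by
  obtain ⟨l, -, rfl⟩ := hr
  refine List.sum_nonneg fun x hx => ?_
  obtain ⟨p, -, rfl⟩ := List.mem_map.1 hx
  positivity

theorem costs_bddBelow (u : AlgProj E F) : BddBelow (costs u) :=
  ⟨0, fun _ hr => costs_nonneg hr⟩

theorem costs_add {u v : AlgProj E F} {r s : ℝ} (hr : r ∈ costs u) (hs : s ∈ costs v) :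
    r + s ∈ costs (u + v) := by
  obtain ⟨l, rfl, rfl⟩ := hr
  obtain ⟨m, rfl, rfl⟩ := hs
  exact ⟨l ++ m, by simp, by simp⟩

theorem costs_tmul (x : E) (y : F) : ‖x‖ * ‖y‖ ∈ costs (tmul x y) :=
  ⟨[(x, y)], by simp, by simp⟩

theorem costs_smul (c : ℂ) {u : AlgProj E F} {r : ℝ} (hr : r ∈ costs u) :
    ‖c‖ * r ∈ costs (c • u) := by
  obtain ⟨l, rfl, rfl⟩ := hr
  refine ⟨l.map fun p => (c • p.1, p.2), ?_, ?_⟩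
  · rw [List.smul_sum, List.map_map, List.map_map]
    rfl
  · rw [← List.sum_map_mul_left, List.map_map]
    congr 1
    refine List.map_congr_left fun p _ => ?_
    simp [norm_smul, mul_assoc]

theorem costs_nonempty (u : AlgProj E F) : (costs u).Nonempty := by
  induction u using TensorProduct.induction_on with
  | zero => exact ⟨0, [], rfl, rfl⟩
  | tmul x y => exact ⟨_, costs_tmul x y⟩
  | add u v hu hv =>
    obtain ⟨r, hr⟩ := hu
    obtain ⟨s, hs⟩ := hv
    exact ⟨_, costs_add hr hs⟩

theorem norm_nonneg' (u : AlgProj E F) : 0 ≤ ‖u‖ :=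
  Real.sInf_nonneg fun _ hr => costs_nonneg hr

theorem norm_tmul_le (x : E) (y : F) : ‖tmul x y‖ ≤ ‖x‖ * ‖y‖ :=
  csInf_le (costs_bddBelow _) (costs_tmul x y)

theorem norm_add_le' (u v : AlgProj E F) : ‖u + v‖ ≤ ‖u‖ + ‖v‖ := by
  refine le_of_forall_pos_le_add fun ε hε => ?_
  obtain ⟨r, hr, hr'⟩ := exists_lt_of_csInf_lt (costs_nonempty u)
    (show sInf (costs u) < ‖u‖ + ε / 2 by rw [norm_def]; linarith)
  obtain ⟨s, hs, hs'⟩ := exists_lt_of_csInf_lt (costs_nonempty v)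
    (show sInf (costs v) < ‖v‖ + ε / 2 by rw [norm_def]; linarith)
  have : ‖u + v‖ ≤ r + s := csInf_le (costs_bddBelow _) (costs_add hr hs)
  linarith

theorem norm_smul_le' (c : ℂ) (u : AlgProj E F) : ‖c • u‖ ≤ ‖c‖ * ‖u‖ := by
  refine le_of_forall_pos_le_add fun ε hε => ?_
  have hc : 0 < ‖c‖ + 1 := by positivity
  obtain ⟨r, hr, hr'⟩ := exists_lt_of_csInf_lt (costs_nonempty u)
    (show sInf (costs u) < ‖u‖ + ε / (‖c‖ + 1) by
      rw [norm_def]; linarith [div_pos hε hc])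
  have h1 : ‖c • u‖ ≤ ‖c‖ * r := csInf_le (costs_bddBelow _) (costs_smul c hr)
  have h2 : ‖c‖ * r ≤ ‖c‖ * (‖u‖ + ε / (‖c‖ + 1)) := by gcongr
  have h3 : ‖c‖ * (ε / (‖c‖ + 1)) ≤ ε := by
    rw [mul_div_assoc', div_le_iff₀ hc]
    nlinarith [norm_nonneg c]
  linarith

theorem norm_zero' : ‖(0 : AlgProj E F)‖ = 0 :=
  le_antisymm (csInf_le (costs_bddBelow _) ⟨[], rfl, rfl⟩) (norm_nonneg' _)

theorem norm_neg' (u : AlgProj E F) : ‖-u‖ = ‖u‖ := by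
  have key : ∀ v : AlgProj E F, ‖-v‖ ≤ ‖v‖ := fun v => by
    simpa using norm_smul_le' (-1) v
  exact le_antisymm (key u) (by simpa using key (-u))

/-- The projective seminorm as an additive group seminorm. -/
noncomputable def projSeminorm (E F : Type*) [SeminormedAddCommGroup E] [NormedSpace ℂ E]
    [SeminormedAddCommGroup F] [NormedSpace ℂ F] : AddGroupSeminorm (AlgProj E F) where
  toFun u := ‖u‖
  map_zero' := norm_zero'
  add_le' := norm_add_le'
  neg' := norm_neg'

noncomputable instance : SeminormedAddCommGroup (AlgProj E F) :=
  (projSeminorm E F).toSeminormedAddCommGroup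

noncomputable instance : NormedSpace ℂ (AlgProj E F) where
  norm_smul_le := norm_smul_le'

theorem norm_map_le {N : Type*} [SeminormedAddCommGroup N] (T : AlgProj E F →+ N) {C : ℝ}
    (hC : 0 ≤ C) (hT : ∀ x y, ‖T (tmul x y)‖ ≤ C * (‖x‖ * ‖y‖)) (u : AlgProj E F) :
    ‖T u‖ ≤ C * ‖u‖ := by
  have key : ∀ r ∈ costs u, ‖T u‖ ≤ C * r := by
    rintro r ⟨l, rfl, rfl⟩
    induction l with
    | nil => simp
    | cons p l ih =>
      simp only [List.map_cons, List.sum_cons, map_add, mul_add]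
      exact (norm_add_le _ _).trans (add_le_add (hT _ _) ih)
  rcases hC.eq_or_lt with rfl | hC'
  · obtain ⟨r, hr⟩ := costs_nonempty u
    simpa using key r hr
  · rw [← div_le_iff₀' hC']
    exact le_csInf (costs_nonempty u) fun r hr => (div_le_iff₀' hC').2 (key r hr)

end Space

section Ring

variable {E F : Type*}
  [NonUnitalNormedRing E] [NormedSpace ℂ E] [IsScalarTower ℂ E E] [SMulCommClass ℂ E E]
  [NonUnitalNormedRing F] [NormedSpace ℂ F] [IsScalarTower ℂ F F] [SMulCommClass ℂ F F]

/-- The algebraic tensor product of algebras, `(x ⊗ y) (x' ⊗ y') = x x' ⊗ y y'`. -/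
noncomputable instance : NonUnitalRing (AlgProj E F) :=
  inferInstanceAs (NonUnitalRing (E ⊗[ℂ] F))

instance : IsScalarTower ℂ (AlgProj E F) (AlgProj E F) :=
  inferInstanceAs (IsScalarTower ℂ (E ⊗[ℂ] F) (E ⊗[ℂ] F))

instance : SMulCommClass ℂ (AlgProj E F) (AlgProj E F) :=
  inferInstanceAs (SMulCommClass ℂ (E ⊗[ℂ] F) (E ⊗[ℂ] F))

theorem tmul_mul_tmul (x x' : E) (y y' : F) :
    tmul x y * tmul x' y' = tmul (x * x') (y * y') :=
  Algebra.TensorProduct.tmul_mul_tmul x x' y y'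

theorem norm_mul_le' (u v : AlgProj E F) : ‖u * v‖ ≤ ‖u‖ * ‖v‖ := by
  rw [mul_comm ‖u‖]
  refine norm_map_le (AddMonoidHom.mulRight v) (norm_nonneg v) (fun x y => ?_) u
  refine (norm_map_le (AddMonoidHom.mulLeft (tmul x y)) (C := ‖x‖ * ‖y‖) (by positivity)
    (fun x' y' => ?_) v).trans_eq (mul_comm _ _)
  change ‖tmul x y * tmul x' y'‖ ≤ _
  rw [tmul_mul_tmul]
  calc _ ≤ ‖x * x'‖ * ‖y * y'‖ := norm_tmul_le _ _
    _ ≤ (‖x‖ * ‖x'‖) * (‖y‖ * ‖y'‖) := by gcongr <;> exact norm_mul_le _ _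
    _ = _ := by ring

noncomputable instance : NonUnitalSeminormedRing (AlgProj E F) :=
  { (inferInstance : SeminormedAddCommGroup (AlgProj E F)),
    (inferInstance : NonUnitalRing (AlgProj E F)) with
    norm_mul_le := norm_mul_le' }

end Ring

end AlgProj

/-- The Banach space projective tensor product: the completion of the algebraic tensor product
in the projective norm. -/
abbrev ProjTensor (E F : Type*) [SeminormedAddCommGroup E] [NormedSpace ℂ E]
    [SeminormedAddCommGroup F] [NormedSpace ℂ F] : Type _ :=
  UniformSpace.Completion (AlgProj E F)

namespace ProjTensor

/-- The elementary tensor `x ⊗ y` in the projective tensor product. -/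
noncomputable def tmul {E F : Type*} [SeminormedAddCommGroup E] [NormedSpace ℂ E]
    [SeminormedAddCommGroup F] [NormedSpace ℂ F] (x : E) (y : F) : ProjTensor E F :=
  ((AlgProj.tmul x y : AlgProj E F) : UniformSpace.Completion (AlgProj E F))

variable {E F : Type*}
  [NonUnitalNormedRing E] [NormedSpace ℂ E] [IsScalarTower ℂ E E] [SMulCommClass ℂ E E]
  [NonUnitalNormedRing F] [NormedSpace ℂ F] [IsScalarTower ℂ F F] [SMulCommClass ℂ F F]

open UniformSpace UniformSpace.Completion

/-- The product of the projective tensor product of two Banach algebras is the continuous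
extension of the product of the algebraic tensor product. -/
noncomputable instance : Mul (ProjTensor E F) :=
  ⟨Function.curry <| (isDenseInducing_coe.prodMap isDenseInducing_coe).extend
    (((↑) : AlgProj E F → Completion (AlgProj E F)) ∘ Function.uncurry (· * ·))⟩

theorem coe_mul (a b : AlgProj E F) :
    ((a * b : AlgProj E F) : ProjTensor E F) = (a : ProjTensor E F) * (b : ProjTensor E F) :=
  ((isDenseInducing_coe.prodMap isDenseInducing_coe).extend_eq
    ((continuous_coe (AlgProj E F)).comp (@continuous_mul (AlgProj E F) _ _ _)) (a, b)).symm

instance : ContinuousMul (ProjTensor E F) where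
  continuous_mul := by
    let m := (AddMonoidHom.mul : AlgProj E F →+ AlgProj E F →+ AlgProj E F).compr₂ toCompl
    have : Continuous fun p : AlgProj E F × AlgProj E F => m p.1 p.2 :=
      (continuous_coe (AlgProj E F)).comp continuous_mul
    have di : IsDenseInducing (toCompl : AlgProj E F → Completion (AlgProj E F)) :=
      isDenseInducing_coe
    exact (di.extend_Z_bilin di this :)

noncomputable instance : NonUnitalNormedRing (ProjTensor E F) :=
  { (inferInstance : NormedAddCommGroup (ProjTensor E F)),
    (inferInstance : Mul (ProjTensor E F)) with
    zero_mul a :=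
      Completion.induction_on a (isClosed_eq (by fun_prop) continuous_const)
        fun a => by rw [← coe_zero, ← coe_mul, zero_mul]
    mul_zero a :=
      Completion.induction_on a (isClosed_eq (by fun_prop) continuous_const)
        fun a => by rw [← coe_zero, ← coe_mul, mul_zero]
    mul_assoc a b c :=
      Completion.induction_on₃ a b c (isClosed_eq (by fun_prop) (by fun_prop))
        fun a b c => by rw [← coe_mul, ← coe_mul, ← coe_mul, ← coe_mul, mul_assoc]
    left_distrib a b c :=
      Completion.induction_on₃ a b c (isClosed_eq (by fun_prop) (by fun_prop))
        fun a b c => by rw [← coe_add, ← coe_mul, ← coe_mul, ← coe_mul, ← coe_add, mul_add]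
    right_distrib a b c :=
      Completion.induction_on₃ a b c (isClosed_eq (by fun_prop) (by fun_prop))
        fun a b c => by rw [← coe_add, ← coe_mul, ← coe_mul, ← coe_mul, ← coe_add, add_mul]
    norm_mul_le a b :=
      Completion.induction_on₂ a b (isClosed_le (by fun_prop) (by fun_prop))
        fun a b => by simpa only [← coe_mul, norm_coe] using norm_mul_le a b }

instance : IsScalarTower ℂ (ProjTensor E F) (ProjTensor E F) where
  smul_assoc c a b :=
    Completion.induction_on₂ a b
      (isClosed_eq ((continuous_fst.const_smul c).mul continuous_snd)
        ((continuous_fst.mul continuous_snd).const_smul c))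
      fun a b => by
        change (c • (a : ProjTensor E F)) * b = c • ((a : ProjTensor E F) * b)
        rw [← Completion.coe_smul, ← coe_mul, ← coe_mul, ← Completion.coe_smul, smul_mul_assoc]

instance : SMulCommClass ℂ (ProjTensor E F) (ProjTensor E F) where
  smul_comm c a b :=
    Completion.induction_on₂ a b
      (isClosed_eq ((continuous_fst.mul continuous_snd).const_smul c)
        (continuous_fst.mul (continuous_snd.const_smul c)))
      fun a b => by
        change c • ((a : ProjTensor E F) * b) = (a : ProjTensor E F) * (c • (b : ProjTensor E F))
        rw [← Completion.coe_smul, ← coe_mul, ← coe_mul, ← Completion.coe_smul, mul_smul_comm]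

theorem tmul_mul_tmul (x x' : E) (y y' : F) :
    tmul x y * tmul x' y' = (tmul (x * x') (y * y') : ProjTensor E F) := by
  rw [tmul, tmul, ← coe_mul, AlgProj.tmul_mul_tmul, tmul]

end ProjTensor

/-! ### The generalized group algebra `L¹(G, A)` -/

namespace GroupAlg

set_option linter.unusedSectionVars false

variable {G : Type*} [Group G] [TopologicalSpace G] [IsTopologicalGroup G]
  [LocallyCompactSpace G] [MeasurableSpace G] [BorelSpace G]
  {μ : Measure G} [μ.IsHaarMeasure] [μ.Regular]
  {A : Type*} [NonUnitalNormedRing A] [NormedSpace ℂ A] [IsScalarTower ℂ A A]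
  [SMulCommClass ℂ A A]

/-- Left translation `(y · g)(x) = g (y⁻¹ x)` on `L¹(G, A)`. -/
noncomputable def translate (y : G) : Lp A 1 μ →L[ℂ] Lp A 1 μ :=
  LinearMap.mkContinuous
    { toFun := fun g => DomMulAct.mk y⁻¹ • g
      map_add' := fun g h => smul_add _ g h
      map_smul' := fun c g => smul_comm _ c g } 1
    (fun g => by simp)

theorem translate_apply (y : G) (g : Lp A 1 μ) : translate y g = DomMulAct.mk y⁻¹ • g := rfl

theorem translate_ae (y : G) (g : Lp A 1 μ) : translate y g =ᵐ[μ] fun x => g (y⁻¹ * x) :=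
  DomMulAct.smul_Lp_ae_eq _ g

theorem norm_translate (y : G) (g : Lp A 1 μ) : ‖translate y g‖ = ‖g‖ :=
  DomMulAct.norm_smul_Lp _ _

theorem translate_mul (y z : G) (g : Lp A 1 μ) :
    translate (y * z) g = translate y (translate z g) := by
  rw [translate_apply, translate_apply, translate_apply, smul_smul, mul_inv_rev]
  rfl

theorem continuous_translate (g : Lp A 1 μ) : Continuous fun y : G => translate y g := by
  have : Fact ((1 : ℝ≥0∞) ≠ ∞) := ⟨ENNReal.one_ne_top⟩
  have h : Continuous fun y : G => DomMulAct.mk y⁻¹ :=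
    DomMulAct.continuous_mk.comp continuous_inv
  exact h.smul continuous_const

variable (μ A) in
/-- Pointwise left multiplication `(a g)(x) = a (g x)` on `L¹(G, A)`, as a continuous bilinear
map. -/
noncomputable def leftMul : A →L[ℂ] Lp A 1 μ →L[ℂ] Lp A 1 μ :=
  (ContinuousLinearMap.mul ℂ A).compLpL₂ 1 μ

theorem leftMul_ae (a : A) (g : Lp A 1 μ) : leftMul μ A a g =ᵐ[μ] fun x => a * g x :=
  (ContinuousLinearMap.mul ℂ A a).coeFn_compLp g

theorem norm_leftMul_le (a : A) (g : Lp A 1 μ) : ‖leftMul μ A a g‖ ≤ ‖a‖ * ‖g‖ := by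
  refine ((leftMul μ A).le_opNorm₂ a g).trans ?_
  have h : ‖leftMul μ A‖ ≤ 1 :=
    (ContinuousLinearMap.norm_compLpL₂_le _).trans (ContinuousLinearMap.opNorm_mul_le ℂ A)
  calc _ ≤ 1 * ‖a‖ * ‖g‖ := by gcongr
    _ = _ := by rw [one_mul]

theorem leftMul_mul (a b : A) (g : Lp A 1 μ) :
    leftMul μ A (a * b) g = leftMul μ A a (leftMul μ A b g) := by
  apply Lp.ext
  filter_upwards [leftMul_ae (μ := μ) (a * b) g, leftMul_ae a (leftMul μ A b g),
    leftMul_ae b g] with x h1 h2 h3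
  rw [h1, h2, h3, mul_assoc]

theorem translate_leftMul (y : G) (a : A) (g : Lp A 1 μ) :
    translate y (leftMul μ A a g) = leftMul μ A a (translate y g) := by
  apply Lp.ext
  have h := (measurePreserving_mul_left μ y⁻¹).quasiMeasurePreserving.ae_eq_comp
    (leftMul_ae (μ := μ) a g)
  filter_upwards [translate_ae y (leftMul μ A a g), leftMul_ae a (translate y g),
    translate_ae y g, h] with x h1 h2 h3 h4
  rw [h1, h2, h3]
  exact h4

/-- Convolution `f * g = ∫ f(y) (y · g) dy` on `L¹(G, A)`, as a Bochner integral in `L¹(G, A)`;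
pointwise, `(f * g)(x) = ∫ f(y) g(y⁻¹ x) dy = ∫ f(x y) g(y⁻¹) dy`
(see `conv_ae_eq` below, on the dense subspace of continuous functions with compact support). -/
noncomputable def conv (f g : Lp A 1 μ) : Lp A 1 μ :=
  ∫ y, leftMul μ A (f y) (translate y g) ∂μ

theorem aestronglyMeasurable_restrict {B : Type*} [NormedAddCommGroup B] {ψ : G → B}
    (hψ : Continuous ψ) {s : Set G} (hs : MeasurableSet s) (hμs : μ s < ∞) :
    AEStronglyMeasurable ψ (μ.restrict s) := by
  have hε : ∀ n : ℕ, ((n : ℝ≥0∞) + 1)⁻¹ ≠ 0 := fun n => by simp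
  choose K hK1 hK2 hK3 hK4 using fun n : ℕ =>
    hs.exists_isCompact_isClosed_sdiff_lt (μ := μ) hμs.ne (hε n)
  have h0 : μ (s \ ⋃ n, K n) = 0 := by
    refine le_antisymm (ENNReal.le_of_forall_pos_le_add fun ε hε' _ => ?_) zero_le
    obtain ⟨n, hn⟩ := ENNReal.exists_inv_nat_lt (ENNReal.coe_ne_zero.2 hε'.ne')
    rw [zero_add]
    calc μ (s \ ⋃ n, K n) ≤ μ (s \ K n) :=
          measure_mono (Set.sdiff_subset_sdiff_right (Set.subset_iUnion K n))
      _ ≤ ((n : ℝ≥0∞) + 1)⁻¹ := (hK4 n).le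
      _ ≤ (n : ℝ≥0∞)⁻¹ := ENNReal.inv_le_inv.2 le_self_add
      _ ≤ ε := hn.le
  have he : (s : Set G) =ᵐ[μ] ⋃ n, K n :=
    Filter.EventuallyLE.antisymm (ae_le_set.2 h0) (Set.iUnion_subset hK1).eventuallyLE
  rw [Measure.restrict_congr_set he]
  exact aestronglyMeasurable_iUnion_iff.2 fun n =>
    hψ.continuousOn.aestronglyMeasurable_of_isCompact (hK2 n) (hK3 n).measurableSet

theorem aestronglyMeasurable_conv {f : G → A} (hf : Integrable f μ) (g : Lp A 1 μ) :
    AEStronglyMeasurable (fun y => leftMul μ A (f y) (translate y g)) μ := by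
  refine Integrable.induction
    (fun f : G → A => AEStronglyMeasurable (fun y => leftMul μ A (f y) (translate y g)) μ)
    ?_ ?_ ?_ ?_ hf
  · intro c s hs hμs
    have h : (fun y => leftMul μ A (s.indicator (fun _ => c) y) (translate y g)) =
        s.indicator fun y => leftMul μ A c (translate y g) := by
      ext1 y
      by_cases hy : y ∈ s <;> simp [hy]
    rw [h, aestronglyMeasurable_indicator_iff hs]
    exact aestronglyMeasurable_restrict
      ((leftMul μ A c).continuous.comp (continuous_translate g)) hs hμs
  · intro f g _ _ _ h1 h2
    refine (h1.add h2).congr (Eventually.of_forall fun y => ?_)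
    simp
  · refine IsSeqClosed.isClosed fun u v hu huv => ?_
    obtain ⟨ns, -, hns⟩ := (tendstoInMeasure_of_tendsto_Lp huv).exists_seq_tendsto_ae
    refine aestronglyMeasurable_of_tendsto_ae atTop (fun n => hu (ns n)) ?_
    filter_upwards [hns] with y hy
    exact (((leftMul μ A).flip (translate y g)).continuous.tendsto _).comp hy
  · intro f f' hff' _ h
    refine h.congr ?_
    filter_upwards [hff'] with y hy
    rw [hy]

theorem integrable_conv {f : G → A} (hf : Integrable f μ) (g : Lp A 1 μ) :
    Integrable (fun y => leftMul μ A (f y) (translate y g)) μ := by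
  have hmeas := aestronglyMeasurable_conv hf g
  refine (hf.norm.mul_const ‖g‖).mono' hmeas (Eventually.of_forall fun y => ?_)
  simpa [norm_translate] using norm_leftMul_le (μ := μ) (f y) (translate y g)

theorem integrable_conv' (f g : Lp A 1 μ) :
    Integrable (fun y => leftMul μ A (f y) (translate y g)) μ :=
  integrable_conv (L1.integrable_coeFn f) g

theorem norm_conv_le (f g : Lp A 1 μ) : ‖conv f g‖ ≤ ‖f‖ * ‖g‖ := by
  rw [L1.norm_eq_integral_norm f, ← integral_mul_const]
  refine norm_integral_le_of_norm_le ((L1.integrable_coeFn f).norm.mul_const ‖g‖)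
    (Eventually.of_forall fun y => ?_)
  simpa [norm_translate] using norm_leftMul_le (μ := μ) (f y) (translate y g)

theorem conv_add (f g h : Lp A 1 μ) : conv f (g + h) = conv f g + conv f h := by
  rw [conv, conv, conv, ← integral_add (integrable_conv' f g) (integrable_conv' f h)]
  simp only [map_add]

theorem add_conv (f g h : Lp A 1 μ) : conv (f + g) h = conv f h + conv g h := by
  rw [conv, conv, conv, ← integral_add (integrable_conv' f h) (integrable_conv' g h)]
  refine integral_congr_ae ?_
  filter_upwards [Lp.coeFn_add f g] with y hy
  rw [hy, Pi.add_apply, map_add, add_apply]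

theorem conv_smul (c : ℂ) (f g : Lp A 1 μ) : conv f (c • g) = c • conv f g := by
  rw [conv, conv, ← integral_smul]
  simp only [map_smul]

theorem smul_conv (c : ℂ) (f g : Lp A 1 μ) : conv (c • f) g = c • conv f g := by
  rw [conv, conv, ← integral_smul]
  refine integral_congr_ae ?_
  filter_upwards [Lp.coeFn_smul c f] with y hy
  rw [hy, Pi.smul_apply, map_smul, smul_apply]

/-- Convolution as a continuous bilinear map. -/
noncomputable def convL : Lp A 1 μ →L[ℂ] Lp A 1 μ →L[ℂ] Lp A 1 μ :=
  LinearMap.mkContinuous₂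
    (LinearMap.mk₂ ℂ conv add_conv smul_conv conv_add conv_smul) 1
    (fun f g => by simpa using norm_conv_le f g)

theorem convL_apply (f g : Lp A 1 μ) : convL f g = conv f g := rfl

variable [CompleteSpace A]

theorem leftMul_conv (a : A) (u h : Lp A 1 μ) :
    conv (leftMul μ A a u) h = leftMul μ A a (conv u h) := by
  rw [conv, conv, ← (leftMul μ A a).integral_comp_comm (integrable_conv' u h)]
  refine integral_congr_ae ?_
  filter_upwards [leftMul_ae a u] with y hy
  rw [hy, leftMul_mul]

theorem translate_conv (y : G) (u h : Lp A 1 μ) :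
    conv (translate y u) h = translate y (conv u h) := by
  rw [conv, conv, ← (translate y).integral_comp_comm (integrable_conv' u h),
    ← integral_mul_left_eq_self (fun x => translate y (leftMul μ A (u x) (translate x h))) y⁻¹]
  refine integral_congr_ae ?_
  filter_upwards [translate_ae y u] with x hx
  rw [hx, translate_leftMul, ← translate_mul, mul_inv_cancel_left]

theorem conv_assoc (f g h : Lp A 1 μ) : conv (conv f g) h = conv f (conv g h) := by
  have key := (convL.flip h).integral_comp_comm (integrable_conv' f g)
  simp only [ContinuousLinearMap.flip_apply, convL_apply] at key
  rw [← conv] at key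
  rw [← key, conv]
  simp only [leftMul_conv, translate_conv]

end GroupAlg

/-- The generalized group algebra `L¹(G, A)`: (classes of) Bochner integrable functions `G → A`
with respect to the Haar measure `μ`, with the norm `∫ ‖f(x)‖ dx` and convolution as product. -/
def GroupAlg {G : Type*} [MeasurableSpace G] (μ : Measure G) (A : Type*)
    [NonUnitalNormedRing A] : Type _ := Lp A 1 μ

namespace GroupAlg

set_option linter.unusedSectionVars false

/-- The underlying element of `Lp A 1 μ`. -/
def toLp {G : Type*} [MeasurableSpace G] {μ : Measure G} {A : Type*} [NonUnitalNormedRing A]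
    (f : GroupAlg μ A) : Lp A 1 μ := f

variable {G : Type*} [Group G] [TopologicalSpace G] [IsTopologicalGroup G]
  [LocallyCompactSpace G] [MeasurableSpace G] [BorelSpace G]
  {μ : Measure G} [μ.IsHaarMeasure] [μ.Regular]
  {A : Type*} [NonUnitalNormedRing A] [NormedSpace ℂ A] [IsScalarTower ℂ A A]
  [SMulCommClass ℂ A A] [CompleteSpace A]

/-- `L¹(G, A)` with convolution and the `L¹`-norm is a Banach algebra. -/
noncomputable instance : NonUnitalNormedRing (GroupAlg μ A) :=
  { (inferInstance : NormedAddCommGroup (Lp A 1 μ)) with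
    mul := conv
    left_distrib := conv_add
    right_distrib := add_conv
    zero_mul := fun g => convL.map_zero₂ g
    mul_zero := fun f => (convL f).map_zero
    mul_assoc := conv_assoc
    norm_mul_le := norm_conv_le }

noncomputable instance : NormedSpace ℂ (GroupAlg μ A) :=
  { (inferInstance : Module ℂ (Lp A 1 μ)) with
    norm_smul_le := fun c (f : Lp A 1 μ) => norm_smul_le c f }

instance : CompleteSpace (GroupAlg μ A) := inferInstanceAs (CompleteSpace (Lp A 1 μ))

instance : IsScalarTower ℂ (GroupAlg μ A) (GroupAlg μ A) := ⟨fun c f g => smul_conv c f g⟩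

instance : SMulCommClass ℂ (GroupAlg μ A) (GroupAlg μ A) :=
  ⟨fun c f g => (conv_smul c f g).symm⟩

theorem mul_def (f g : GroupAlg μ A) : toLp (f * g) = conv (toLp f) (toLp g) := rfl

theorem norm_eq (f : GroupAlg μ A) : ‖f‖ = ∫ x, ‖f.toLp x‖ ∂μ :=
  L1.norm_eq_integral_norm (toLp f)

/-- On continuous functions with compact support the product of `L¹(G, A)` is the pointwise
convolution. -/
theorem conv_ae_eq {f g : G → A} (hf : Continuous f) (hcf : HasCompactSupport f)
    (hg : Continuous g) (hcg : HasCompactSupport g) (F H : GroupAlg μ A) (hF : ⇑F.toLp =ᵐ[μ] f)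
    (hH : ⇑H.toLp =ᵐ[μ] g) :
    ⇑(F * H).toLp =ᵐ[μ] fun x => ∫ y, f (x * y) * g y⁻¹ ∂μ := by
  have hpt : ∀ x, ∫ y, f (x * y) * g y⁻¹ ∂μ = ∫ y, f y * g (y⁻¹ * x) ∂μ := fun x => by
    rw [← integral_mul_left_eq_self (fun y => f y * g (y⁻¹ * x)) x]
    simp
  simp only [hpt]
  have hk : Continuous (Function.uncurry fun y x : G => f y * g (y⁻¹ * x)) := by
    unfold Function.uncurry
    fun_prop
  have hks : HasCompactSupport (Function.uncurry fun y x : G => f y * g (y⁻¹ * x)) := by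
    refine HasCompactSupport.intro' (K := (fun p : G × G => (p.1, p.1 * p.2)) ''
      (tsupport f ×ˢ tsupport g)) ((hcf.isCompact.prod hcg.isCompact).image (by fun_prop)) ?_ ?_
    · have e : (fun p : G × G => (p.1, p.1 * p.2)) '' (tsupport f ×ˢ tsupport g) =
          (fun p : G × G => (p.1, p.1⁻¹ * p.2)) ⁻¹' (tsupport f ×ˢ tsupport g) := by
        ext ⟨a, b⟩
        constructor
        · rintro ⟨⟨c, d⟩, hcd, h⟩
          simp only [Prod.mk.injEq] at h
          obtain ⟨rfl, rfl⟩ := h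
          simpa using hcd
        · intro h
          exact ⟨(a, a⁻¹ * b), h, by simp⟩
      rw [e]
      exact ((isClosed_tsupport f).prod (isClosed_tsupport g)).preimage (by fun_prop)
    · rintro ⟨a, b⟩ hab
      by_contra hne
      refine hab ⟨(a, a⁻¹ * b), ⟨subset_tsupport _ fun h => hne ?_,
        subset_tsupport _ fun h => hne ?_⟩, by simp⟩
      · simp [Function.uncurry, h]
      · simp only [] at h
        simp [Function.uncurry, h]
  have hv : Integrable (fun x => ∫ y, f y * g (y⁻¹ * x) ∂μ) μ := by
    refine Continuous.integrable_of_hasCompactSupport ?_ ?_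
    · have h : ContinuousOn (fun x => ∫ y, f y * g (y⁻¹ * x) ∂μ) Set.univ := by
        refine continuousOn_integral_of_compact_support hcf.isCompact ?_ ?_
        · exact Continuous.continuousOn (by unfold Function.uncurry; fun_prop)
        · intro p x _ hx
          rw [image_eq_zero_of_notMem_tsupport hx, zero_mul]
      exact continuousOn_univ.1 h
    · refine HasCompactSupport.intro (hks.isCompact.image continuous_snd) fun x hx => ?_
      refine integral_eq_zero_of_ae (Eventually.of_forall fun y => ?_)
      by_contra hy
      exact hx ⟨(y, x), subset_tsupport _ hy, rfl⟩
  refine Integrable.ae_eq_of_forall_setIntegral_eq _ _ (L1.integrable_coeFn _) hv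
    fun S hS hμS => ?_
  let J : Lp A 1 μ →L[ℂ] A := LinearMap.mkContinuous
    { toFun := fun u => ∫ x in S, u x ∂μ
      map_add' := fun u v => by
        rw [← integral_add (L1.integrable_coeFn u).integrableOn
          (L1.integrable_coeFn v).integrableOn]
        exact integral_congr_ae (ae_restrict_of_ae (Lp.coeFn_add u v))
      map_smul' := fun c u => by
        rw [RingHom.id_apply, ← integral_smul]
        exact integral_congr_ae (ae_restrict_of_ae (Lp.coeFn_smul c u)) } 1
    (fun u => by
      rw [one_mul, L1.norm_eq_integral_norm]
      exact (norm_integral_le_integral_norm _).trans (setIntegral_le_integral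
        (L1.integrable_coeFn u).norm (Eventually.of_forall fun _ => norm_nonneg _)))
  have hJ : ∀ u : Lp A 1 μ, J u = ∫ x in S, u x ∂μ := fun _ => rfl
  rw [← hJ, mul_def, conv, ← J.integral_comp_comm (integrable_conv' F.toLp H.toLp),
    ← integral_integral_swap_of_hasCompactSupport hk hks]
  refine integral_congr_ae ?_
  filter_upwards [hF] with y hy
  rw [hJ]
  refine integral_congr_ae (ae_restrict_of_ae ?_)
  have h := (measurePreserving_mul_left μ y⁻¹).quasiMeasurePreserving.ae_eq_comp hH
  filter_upwards [leftMul_ae (F.toLp y) (translate y H.toLp),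
    translate_ae y H.toLp, h] with x h1 h2 h3
  rw [h1, h2, hy]
  exact congrArg _ h3

end GroupAlg

/-! ### The hypotheses -/

/-- `G` is an [IN] group: the identity has a compact neighbourhood that is invariant under all
inner automorphisms. -/
def IsINGroup (G : Type*) [Group G] [TopologicalSpace G] : Prop :=
  ∃ K : Set G, IsCompact K ∧ K ∈ 𝓝 (1 : G) ∧ ∀ y : G, (fun x => y * x * y⁻¹) '' K = K

/-- The net `a` is a bounded `Z(A)`-approximate identity of `A`: it is norm-bounded and
`a i * z → z` for every `z` in the centre of `A`. -/
def IsBoundedCenterApproxIdentity {A ι : Type*} [NonUnitalNormedRing A] [Preorder ι]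
    (a : ι → A) : Prop :=
  (∃ M : ℝ, ∀ i, ‖a i‖ ≤ M) ∧
    ∀ z ∈ Set.center A, Tendsto (fun i => a i * z) atTop (𝓝 z)

/-! Both centres are `L¹`-spaces over one measure space, and the projective tensor product turns
scalar `L¹` into vector-valued `L¹`.

An [IN] group is unimodular: the invariant compact neighbourhood has positive finite measure, and
right translation cannot rescale it. Hence `f * g` is also a mean of right translates of `f` with
weights `g(y)`, while `g * f` is a mean of left translates of `f` with the same weights
(`conv_eq_rconv`). Testing centrality of `f` against `1_K a` with `K` compact localises it to the
identity `a · f(t⁻¹ x) = f(x t⁻¹) · a` for all `a` and `t` (`leftMul_translate_of_mem_center`). The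
case `t = 1` shows that `f` takes values in `Z(A)`. The difference of the two translates is then
central-valued and annihilated by `A`, so the approximate identity makes it zero, and `f` is
invariant under inner automorphisms.

Let `Σ` be the σ-algebra of measurable sets that each inner automorphism preserves up to a null set,
and let `ν` be the restriction of Haar measure to `Σ`. The invariant functions are the
`Σ`-measurable ones, so `Z(L¹(G, A))` is `L¹(ν, Z(A))` (`exists_center_equiv`); for `A = ℂ`,
`Z(L¹(G))` is `L¹(ν)`. Grothendieck's identification of `L¹(ν) ⊗^γ E` with `L¹(ν, E)`
(`exists_linearIsometryEquiv_L1`), applied to `E = Z(A)`, gives the isometry. Working over `ν`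
matters, because a projective tensor product of subspaces need not embed isometrically in that of
the ambient spaces. Multiplicativity is checked on elementary tensors (`conv_smulVec`) and extends
by linearity and continuity. -/

/-! ### The projective tensor product with an `L¹`-space -/

namespace ProjTensor

/-! ### Elementary tensors and the universal property for contractive bilinear maps. -/

section Linear

variable {E F N : Type*} [NormedAddCommGroup E] [NormedSpace ℂ E]
  [NormedAddCommGroup F] [NormedSpace ℂ F] [NormedAddCommGroup N] [NormedSpace ℂ N]

/-- Shortcut: the norm of `AlgProj` is taken from its seminormed group structure. -/
noncomputable local instance : Norm (AlgProj F E) := SeminormedAddCommGroup.toNorm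

theorem norm_tmul_le (x : F) (y : E) : ‖(tmul x y : ProjTensor F E)‖ ≤ ‖x‖ * ‖y‖ := by
  rw [tmul, UniformSpace.Completion.norm_coe]
  exact AlgProj.norm_tmul_le x y

theorem tmul_add (x : F) (y z : E) : (tmul x (y + z) : ProjTensor F E) = tmul x y + tmul x z := by
  rw [tmul, tmul, tmul, ← UniformSpace.Completion.coe_add]
  exact congrArg _ (TensorProduct.tmul_add x y z)

theorem add_tmul (x x' : F) (y : E) :
    (tmul (x + x') y : ProjTensor F E) = tmul x y + tmul x' y := by
  rw [tmul, tmul, tmul, ← UniformSpace.Completion.coe_add]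
  exact congrArg _ (TensorProduct.add_tmul x x' y)

theorem tmul_smul (c : ℂ) (x : F) (y : E) :
    (tmul x (c • y) : ProjTensor F E) = c • tmul x y := by
  rw [tmul, tmul, ← UniformSpace.Completion.coe_smul]
  exact congrArg _ (TensorProduct.tmul_smul c x y)

theorem smul_tmul (c : ℂ) (x : F) (y : E) :
    (tmul (c • x) y : ProjTensor F E) = c • tmul x y := by
  rw [tmul, tmul, ← UniformSpace.Completion.coe_smul]
  exact congrArg _ (TensorProduct.smul_tmul' c x y).symm

variable (E F) in
/-- The elementary tensors as a continuous bilinear map. -/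
noncomputable def tmulL : F →L[ℂ] E →L[ℂ] ProjTensor F E :=
  LinearMap.mkContinuous₂ (LinearMap.mk₂ ℂ tmul add_tmul smul_tmul tmul_add tmul_smul) 1
    (fun x y => by simpa using norm_tmul_le x y)

theorem tmulL_apply (x : F) (y : E) : tmulL E F x y = tmul x y := rfl

/-- A closed property that is additive and holds for elementary tensors holds everywhere. -/
theorem induction {P : ProjTensor F E → Prop} (hP : IsClosed {u | P u})
    (h_zero : P 0) (h_tmul : ∀ x y, P (tmul x y)) (h_add : ∀ u v, P u → P v → P (u + v))
    (u : ProjTensor F E) : P u := by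
  refine UniformSpace.Completion.induction_on u hP fun w => ?_
  refine TensorProduct.induction_on (motive := fun w : F ⊗[ℂ] E =>
    P (UniformSpace.Completion.coe' (α := AlgProj F E) w)) w h_zero h_tmul fun v w hv hw => ?_
  exact (congrArg P (UniformSpace.Completion.coe_add (α := AlgProj F E) v w)).mpr
    (h_add _ _ hv hw)

/-- The continuous linear map induced by a contractive bilinear map. -/
theorem exists_lift [CompleteSpace N] (B : F →L[ℂ] E →L[ℂ] N)
    (hB : ∀ x y, ‖B x y‖ ≤ ‖x‖ * ‖y‖) :
    ∃ T : ProjTensor F E →L[ℂ] N, (∀ x y, T (tmul x y) = B x y) ∧ ∀ u, ‖T u‖ ≤ ‖u‖ := by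
  let T₀ : AlgProj F E →ₗ[ℂ] N :=
    TensorProduct.lift ((ContinuousLinearMap.coeLM ℂ).comp (B : F →ₗ[ℂ] E →L[ℂ] N))
  have h0 : ∀ x y, T₀ (AlgProj.tmul x y) = B x y := fun x y => TensorProduct.lift.tmul x y
  have h1 : ∀ u, ‖T₀ u‖ ≤ 1 * ‖u‖ :=
    AlgProj.norm_map_le T₀.toAddMonoidHom zero_le_one fun x y => by
      rw [one_mul]
      exact (congrArg norm (h0 x y)).trans_le (hB x y)
  refine ⟨(T₀.mkContinuous 1 h1).fromCompletion, fun x y => ?_, fun u => ?_⟩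
  · rw [tmul, ContinuousLinearMap.fromCompletion_apply_coe]
    exact h0 x y
  · refine UniformSpace.Completion.induction_on u (isClosed_le (by fun_prop) (by fun_prop))
      fun w => ?_
    rw [ContinuousLinearMap.fromCompletion_apply_coe, UniformSpace.Completion.norm_coe]
    simpa using h1 w

end Linear

/-! ### Grothendieck's isometry for the projective tensor product with `L¹`. -/

section L1

variable {X : Type*} {mX : MeasurableSpace X} {ν : Measure X}
  {E F : Type*} [NormedAddCommGroup E] [NormedSpace ℂ E] [NormedAddCommGroup F] [NormedSpace ℂ F]

/-- Shortcut: the norm of `AlgProj` is taken from its seminormed group structure. -/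
noncomputable local instance : Norm (AlgProj F E) := SeminormedAddCommGroup.toNorm

open Classical in
/-- The vector measure `S ↦ (y ↦ 1_S ⊗ y)`, for a normed space `F` identified with `L¹(ν)`. -/
noncomputable def indicatorTmul (E : Type*) [NormedAddCommGroup E] [NormedSpace ℂ E]
    (e : F ≃ₗᵢ[ℂ] Lp ℂ 1 ν) (s : Set X) : E →L[ℂ] ProjTensor F E :=
  if h : MeasurableSet s ∧ ν s ≠ ∞ then
    tmulL E F (e.symm (indicatorConstLp 1 h.1 h.2 (1 : ℂ))) else 0

theorem indicatorTmul_of_measurableSet (e : F ≃ₗᵢ[ℂ] Lp ℂ 1 ν) {s : Set X} (hs : MeasurableSet s)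
    (hνs : ν s ≠ ∞) :
    indicatorTmul E e s = tmulL E F (e.symm (indicatorConstLp 1 hs hνs (1 : ℂ))) :=
  dif_pos ⟨hs, hνs⟩

/-- The bound is `‖1_S‖ ‖y‖ = ν(S) ‖y‖`. The constant `1` is what makes the integral against this
vector measure a contraction on `L¹(ν, E)`. -/
theorem dominatedFinMeasAdditive_indicatorTmul (e : F ≃ₗᵢ[ℂ] Lp ℂ 1 ν) :
    DominatedFinMeasAdditive ν
      (fun s => (indicatorTmul E e s).restrictScalars ℝ) 1 := by
  refine ⟨fun s t hs ht hνs hνt hst => ?_, fun s hs hνs => ?_⟩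
  · have hu : ν (s ∪ t) ≠ ∞ := by finiteness
    ext y
    change indicatorTmul E e (s ∪ t) y = indicatorTmul E e s y + indicatorTmul E e t y
    rw [indicatorTmul_of_measurableSet e hs hνs, indicatorTmul_of_measurableSet e ht hνt,
      indicatorTmul_of_measurableSet e (hs.union ht) hu,
      indicatorConstLp_disjoint_union hs ht hνs hνt hst, map_add, map_add,
      add_apply]
  · refine ContinuousLinearMap.opNorm_le_bound _ (by positivity) fun y => ?_
    change ‖indicatorTmul E e s y‖ ≤ _
    rw [indicatorTmul_of_measurableSet e hs hνs.ne, tmulL_apply]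
    refine (norm_tmul_le _ _).trans_eq ?_
    rw [LinearIsometryEquiv.norm_map, norm_indicatorConstLp one_ne_zero ENNReal.one_ne_top]
    simp

/-- `L¹(ν) ⊗^γ E ≅ L¹(ν, E)`. -/
theorem exists_linearIsometryEquiv_L1 [CompleteSpace E] (e : F ≃ₗᵢ[ℂ] Lp ℂ 1 ν) :
    ∃ Θ : ProjTensor F E ≃ₗᵢ[ℂ] Lp E 1 ν,
      ∀ f z, Θ (tmul f z) =ᵐ[ν] fun x => e f x • z := by
  let B₀ : E →L[ℂ] Lp ℂ 1 ν →L[ℂ] Lp E 1 ν :=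
    (ContinuousLinearMap.lsmul ℂ ℂ).flip.compLpL₂ 1 ν
  have hB₀ : ∀ z f, B₀ z f =ᵐ[ν] fun x => f x • z := fun z f =>
    ((ContinuousLinearMap.lsmul ℂ ℂ).flip z).coeFn_compLp f
  let B : F →L[ℂ] E →L[ℂ] Lp E 1 ν := B₀.flip.comp (e : F →L[ℂ] Lp ℂ 1 ν)
  have hBe : ∀ f z, B f z = B₀ z (e f) := fun f z => rfl
  have hB : ∀ f z, B f z =ᵐ[ν] fun x => e f x • z := fun f z => hB₀ z (e f)
  obtain ⟨T, hT, hTn⟩ := exists_lift B fun f z => by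
    rw [L1.norm_eq_integral_norm, ← e.norm_map f, L1.norm_eq_integral_norm, ← integral_mul_const]
    refine (integral_congr_ae ?_).le
    filter_upwards [hB f z] with x hx
    rw [hx, norm_smul]
  have hD := dominatedFinMeasAdditive_indicatorTmul (E := E) e
  -- The inverse candidate integrates against `S ↦ 1_S ⊗ ·`. Both `T` and `Ψ` are contractions, so
  -- being mutually inverse already makes them isometric.
  let Ψ : Lp E 1 ν →L[ℂ] ProjTensor F E := L1.setToL1' ℂ hD fun c s x =>
    (indicatorTmul E e s).map_smul c x
  have hΨ : ∀ u, Ψ u = L1.setToL1 hD u := fun u =>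
    (L1.setToL1_eq_setToL1' (𝕜 := ℂ) hD (fun c s x => (indicatorTmul E e s).map_smul c x) u).symm
  have hΨn : ∀ u, ‖Ψ u‖ ≤ ‖u‖ := fun u => by
    rw [hΨ]
    simpa using L1.norm_setToL1_le_mul_norm hD zero_le_one u
  have hΨi : ∀ (z : E) {s : Set X} (hs : MeasurableSet s) (hνs : ν s ≠ ∞),
      Ψ (indicatorConstLp 1 hs hνs z) = tmul (e.symm (indicatorConstLp 1 hs hνs (1 : ℂ))) z :=
    fun z s hs hνs => by
      rw [hΨ, L1.setToL1_indicatorConstLp hD hs hνs]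
      change indicatorTmul E e s z = _
      rw [indicatorTmul_of_measurableSet e hs hνs, tmulL_apply]
  have hB₀i : ∀ (z : E) (c : ℂ) {s : Set X} (hs : MeasurableSet s) (hνs : ν s ≠ ∞),
      B₀ z (indicatorConstLp 1 hs hνs c) = indicatorConstLp 1 hs hνs (c • z) :=
    fun z c s hs hνs => by
      refine Lp.ext ((hB₀ z _).trans ?_)
      filter_upwards [indicatorConstLp_coeFn (p := 1) (hs := hs) (hμs := hνs) (c := c),
        indicatorConstLp_coeFn (p := 1) (hs := hs) (hμs := hνs) (c := c • z)] with x h1 h2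
      rw [h1, h2]
      by_cases hx : x ∈ s <;> simp [hx]
  have hi : ∀ (c : ℂ) {s : Set X} (hs : MeasurableSet s) (hνs : ν s ≠ ∞),
      (indicatorConstLp 1 hs hνs c : Lp ℂ 1 ν) = c • indicatorConstLp 1 hs hνs (1 : ℂ) :=
    fun c s hs hνs => by
      refine Lp.ext ?_
      filter_upwards [indicatorConstLp_coeFn (p := 1) (hs := hs) (hμs := hνs) (c := c),
        indicatorConstLp_coeFn (p := 1) (hs := hs) (hμs := hνs) (c := (1 : ℂ)),
        Lp.coeFn_smul c (indicatorConstLp 1 hs hνs (1 : ℂ) : Lp ℂ 1 ν)] with x h1 h2 h3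
      rw [h1, h3, Pi.smul_apply, h2]
      by_cases hx : x ∈ s <;> simp [hx]
  have hTΨ : ∀ u, T (Ψ u) = u := fun u => by
    induction u using Lp.induction ENNReal.one_ne_top with
    | indicatorConst z hs hνs =>
      rw [Lp.simpleFunc.coe_indicatorConst, hΨi, hT, hBe, e.apply_symm_apply, hB₀i, one_smul]
    | add hf hg _ h1 h2 => rw [map_add, map_add, h1, h2]
    | isClosed => exact isClosed_eq (by fun_prop) continuous_id
  -- For fixed `z` both sides are continuous and linear in `g`, so indicators suffice; there the
  -- scalar `c` moves across the tensor sign.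
  have hΨT₀ : ∀ (z : E) (g : Lp ℂ 1 ν), Ψ (B₀ z g) = tmulL E F (e.symm g) z := fun z g => by
    induction g using Lp.induction ENNReal.one_ne_top with
    | indicatorConst c hs hνs =>
      rw [Lp.simpleFunc.coe_indicatorConst, hB₀i, hΨi, tmulL_apply, tmul_smul, ← smul_tmul,
        ← map_smul, ← hi]
    | add hf hg _ h1 h2 => simp only [map_add, h1, h2, add_apply]
    | isClosed =>
      refine isClosed_eq (by fun_prop) ?_
      have : Continuous fun g : Lp ℂ 1 ν => (tmulL E F).flip z (e.symm g) :=
        ((tmulL E F).flip z).continuous.comp e.symm.continuous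
      exact this
  have hΨT : ∀ u, Ψ (T u) = u := fun u => by
    refine induction (P := fun u => Ψ (T u) = u) (isClosed_eq (by fun_prop) continuous_id)
      (by simp) (fun f z => ?_) (fun u v hu hv => by rw [map_add, map_add, hu, hv]) u
    rw [hT, hBe, hΨT₀, e.symm_apply_apply, tmulL_apply]
  refine ⟨⟨LinearEquiv.ofLinearMap (T : ProjTensor F E →ₗ[ℂ] Lp E 1 ν)
    (Ψ : Lp E 1 ν →ₗ[ℂ] ProjTensor F E) (LinearMap.ext hTΨ) (LinearMap.ext hΨT), fun u => ?_⟩,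
    fun f z => ?_⟩
  · refine le_antisymm (hTn u) ?_
    calc ‖u‖ = ‖Ψ (T u)‖ := by rw [hΨT]
      _ ≤ ‖T u‖ := hΨn _
  · change ⇑(T (tmul f z)) =ᵐ[ν] _
    rw [hT]
    exact hB f z

end L1

end ProjTensor

/-! ### Unimodularity of [IN] groups -/

section Unimodular

variable {G : Type*} [Group G] [TopologicalSpace G] [IsTopologicalGroup G]
  [LocallyCompactSpace G] [MeasurableSpace G] [BorelSpace G]
  (μ : Measure G) [μ.IsHaarMeasure] [μ.Regular]

/-- The right translate of `μ` is again left invariant and regular, hence a multiple of `μ`; the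
invariant set `K`, of positive finite measure, forces the factor to be `1`. -/
theorem IsINGroup.isMulRightInvariant [T2Space G] (hG : IsINGroup G) : μ.IsMulRightInvariant := by
  obtain ⟨K, hK, hK1, hKinv⟩ := hG
  refine ⟨fun g => ?_⟩
  have hreg : (Measure.map (· * g) μ).Regular := Measure.Regular.map (Homeomorph.mulRight g)
  have hc := Measure.isMulLeftInvariant_eq_smul_of_regular (Measure.map (· * g) μ) μ
  have hμK : Measure.map (· * g) μ K = μ K := by
    -- Left invariance replaces `{x | x g ∈ K}` by `{x | g⁻¹ x g ∈ K}`, which is `K`.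
    rw [Measure.map_apply (measurable_mul_const g) hK.measurableSet,
      ← measure_preimage_mul μ g⁻¹]
    congr 1
    ext x
    constructor
    · intro hx
      rw [← hKinv g]
      exact ⟨g⁻¹ * x * g, hx, by group⟩
    · intro hx
      rw [← hKinv g⁻¹]
      exact ⟨x, hx, by simp⟩
  have h0 : μ K ≠ 0 := (Measure.measure_pos_of_mem_nhds μ hK1).ne'
  have h1 := hμK
  rw [hc, Measure.smul_apply, ENNReal.smul_def, smul_eq_mul] at h1
  have h2 := (ENNReal.mul_left_inj h0 hK.measure_lt_top.ne).1 (h1.trans (one_mul (μ K)).symm)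
  rw [hc, ENNReal.coe_eq_one.1 h2, one_smul]

/-- Right invariance makes `μ.inv` a left Haar measure, so `μ.inv = c • μ`. Inverting twice gives `c
^ 2 = 1`, hence `c = 1`. -/
theorem isInvInvariant_of_isMulRightInvariant [μ.IsMulRightInvariant] : μ.IsInvInvariant := by
  constructor
  have hreg : μ.inv.Regular := Measure.Regular.map (Homeomorph.inv G)
  let c : ℝ≥0∞ := Measure.haarScalarFactor μ.inv μ
  have hc : μ.inv = c • μ := Measure.isMulLeftInvariant_eq_smul_of_regular μ.inv μ
  have h2 : Measure.map Inv.inv (Measure.map Inv.inv μ) = c ^ 2 • μ := by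
    rw [← Measure.inv_def μ, hc, Measure.map_smul, ← Measure.inv_def μ, hc, smul_smul, pow_two]
  have μeq : μ = c ^ 2 • μ := by
    rw [Measure.map_map continuous_inv.measurable continuous_inv.measurable] at h2
    simpa only [inv_involutive, Function.Involutive.comp_self, Measure.map_id] using h2
  have K : TopologicalSpace.PositiveCompacts G := Classical.arbitrary _
  have h3 : c ^ 2 * μ K = 1 ^ 2 * μ K := by
    conv_rhs => rw [μeq]
    simp
  have h4 : c ^ 2 = 1 ^ 2 :=
    (ENNReal.mul_left_inj (Measure.measure_pos_of_nonempty_interior _ K.interior_nonempty).ne'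
      K.isCompact.measure_lt_top.ne).1 h3
  have h5 : c = 1 := (ENNReal.pow_right_strictMono two_ne_zero).injective h4
  rw [hc, h5, one_smul]

end Unimodular

/-! ### Convolution as a mean of right translates -/

namespace GroupAlg

set_option linter.unusedSectionVars false

variable {G : Type*} [Group G] [TopologicalSpace G] [IsTopologicalGroup G]
  [LocallyCompactSpace G] [MeasurableSpace G] [BorelSpace G]
  {μ : Measure G} [μ.IsHaarMeasure] [μ.Regular]
  {A : Type*} [NonUnitalNormedRing A] [NormedSpace ℂ A] [IsScalarTower ℂ A A]
  [SMulCommClass ℂ A A]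

/-- Since `G` need not be σ-compact, a continuous `φ` alone may fail to be almost everywhere
strongly measurable. The factor `g` is approximated by functions supported on sets of finite
measure, and those are σ-compact up to a null set. -/
theorem aestronglyMeasurable_clm_apply {N : Type*} [NormedAddCommGroup N] [NormedSpace ℂ N]
    (B : A →L[ℂ] N →L[ℂ] N) {g : G → A} (hg : Integrable g μ) {φ : G → N} (hφ : Continuous φ) :
    AEStronglyMeasurable (fun y => B (g y) (φ y)) μ := by
  refine Integrable.induction
    (fun g : G → A => AEStronglyMeasurable (fun y => B (g y) (φ y)) μ) ?_ ?_ ?_ ?_ hg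
  · intro c s hs hμs
    have h : (fun y => B (s.indicator (fun _ => c) y) (φ y)) =
        s.indicator fun y => B c (φ y) := by
      ext1 y
      by_cases hy : y ∈ s <;> simp [hy]
    rw [h, aestronglyMeasurable_indicator_iff hs]
    exact aestronglyMeasurable_restrict ((B c).continuous.comp hφ) hs hμs
  · intro f g _ _ _ h1 h2
    refine (h1.add h2).congr (Eventually.of_forall fun y => ?_)
    simp
  · refine IsSeqClosed.isClosed fun u v hu huv => ?_
    obtain ⟨ns, -, hns⟩ := (tendstoInMeasure_of_tendsto_Lp huv).exists_seq_tendsto_ae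
    refine aestronglyMeasurable_of_tendsto_ae atTop (fun n => hu (ns n)) ?_
    filter_upwards [hns] with y hy
    exact ((B.flip (φ y)).continuous.tendsto _).comp hy
  · intro f f' hff' _ h
    refine h.congr ?_
    filter_upwards [hff'] with y hy
    rw [hy]

variable (μ A) in
/-- Pointwise right multiplication `(g a)(x) = (g x) a` on `L¹(G, A)`, as a continuous bilinear
map. -/
noncomputable def rightMul : A →L[ℂ] Lp A 1 μ →L[ℂ] Lp A 1 μ :=
  (ContinuousLinearMap.mul ℂ A).flip.compLpL₂ 1 μ

theorem rightMul_ae (a : A) (g : Lp A 1 μ) : rightMul μ A a g =ᵐ[μ] fun x => g x * a :=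
  ((ContinuousLinearMap.mul ℂ A).flip a).coeFn_compLp g

theorem norm_rightMul_le (a : A) (g : Lp A 1 μ) : ‖rightMul μ A a g‖ ≤ ‖a‖ * ‖g‖ := by
  refine ((rightMul μ A).le_opNorm₂ a g).trans ?_
  have h : ‖rightMul μ A‖ ≤ 1 :=
    (ContinuousLinearMap.norm_compLpL₂_le _).trans
      ((ContinuousLinearMap.opNorm_flip _).le.trans (ContinuousLinearMap.opNorm_mul_le ℂ A))
  calc _ ≤ 1 * ‖a‖ * ‖g‖ := by gcongr
    _ = _ := by rw [one_mul]

section Right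

variable [μ.IsMulRightInvariant]

/-- Right translation `x ↦ g (x y)` on `L¹(G, A)`. -/
noncomputable def rtranslate (y : G) : Lp A 1 μ →L[ℂ] Lp A 1 μ :=
  LinearMap.mkContinuous
    { toFun := fun g => DomMulAct.mk (MulOpposite.op y) • g
      map_add' := fun g h => smul_add _ g h
      map_smul' := fun c g => smul_comm _ c g } 1
    (fun g => by simp)

theorem rtranslate_ae (y : G) (g : Lp A 1 μ) : rtranslate y g =ᵐ[μ] fun x => g (x * y) :=
  DomMulAct.smul_Lp_ae_eq _ g

theorem norm_rtranslate (y : G) (g : Lp A 1 μ) : ‖rtranslate y g‖ = ‖g‖ :=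
  DomMulAct.norm_smul_Lp _ _

theorem continuous_rtranslate (g : Lp A 1 μ) : Continuous fun y : G => rtranslate y g := by
  have : Fact ((1 : ℝ≥0∞) ≠ ∞) := ⟨ENNReal.one_ne_top⟩
  -- Right translation is the action of the opposite group, whose topology and σ-algebra must be
  -- compatible for continuity of translation in `L¹`.
  have : OpensMeasurableSpace Gᵐᵒᵖ := ⟨MeasurableSpace.generateFrom_le fun _ hs =>
    (IsOpen.preimage MulOpposite.continuous_op hs).measurableSet⟩
  have h : Continuous fun y : G => DomMulAct.mk (MulOpposite.op y) :=
    DomMulAct.continuous_mk.comp MulOpposite.continuous_op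
  exact h.smul continuous_const

/-- The convolution `f * g = ∫ (x ↦ f(x y⁻¹)) g(y) dy` on a unimodular group, as a mean of right
translates of `f`. -/
noncomputable def rconv (f g : Lp A 1 μ) : Lp A 1 μ :=
  ∫ y, rightMul μ A (g y) (rtranslate y⁻¹ f) ∂μ

theorem norm_rightMul_rtranslate_le (a : A) (y : G) (f : Lp A 1 μ) :
    ‖rightMul μ A a (rtranslate y⁻¹ f)‖ ≤ ‖a‖ * ‖f‖ := by
  simpa [norm_rtranslate] using norm_rightMul_le (μ := μ) a (rtranslate y⁻¹ f)

theorem integrable_rconv (f g : Lp A 1 μ) :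
    Integrable (fun y => rightMul μ A (g y) (rtranslate y⁻¹ f)) μ := by
  refine ((L1.integrable_coeFn g).norm.mul_const ‖f‖).mono'
    (aestronglyMeasurable_clm_apply (rightMul μ A) (L1.integrable_coeFn g)
      ((continuous_rtranslate f).comp continuous_inv))
    (Eventually.of_forall fun y => norm_rightMul_rtranslate_le (g y) y f)

theorem norm_rconv_le (f g : Lp A 1 μ) : ‖rconv f g‖ ≤ ‖f‖ * ‖g‖ := by
  rw [L1.norm_eq_integral_norm g, mul_comm, ← integral_mul_const]
  exact norm_integral_le_of_norm_le ((L1.integrable_coeFn g).norm.mul_const ‖f‖)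
    (Eventually.of_forall fun y => norm_rightMul_rtranslate_le (g y) y f)

/-- `rconv` as a continuous bilinear map. -/
noncomputable def rconvL : Lp A 1 μ →L[ℂ] Lp A 1 μ →L[ℂ] Lp A 1 μ :=
  LinearMap.mkContinuous₂
    (LinearMap.mk₂ ℂ rconv
      (fun f f' g => by
        rw [rconv, rconv, rconv, ← integral_add (integrable_rconv f g) (integrable_rconv f' g)]
        simp only [map_add])
      (fun c f g => by
        rw [rconv, rconv, ← integral_smul]
        simp only [map_smul])
      (fun f g g' => by
        rw [rconv, rconv, rconv, ← integral_add (integrable_rconv f g) (integrable_rconv f g')]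
        refine integral_congr_ae ?_
        filter_upwards [Lp.coeFn_add g g'] with y hy
        rw [hy, Pi.add_apply, map_add, add_apply])
      (fun c f g => by
        rw [rconv, rconv, ← integral_smul]
        refine integral_congr_ae ?_
        filter_upwards [Lp.coeFn_smul c g] with y hy
        rw [hy, Pi.smul_apply, map_smul, smul_apply])) 1
    (fun f g => by simpa using norm_rconv_le f g)

end Right

/-- The functions that agree almost everywhere with a continuous function of compact support are
dense in `L¹(G, A)`. -/
theorem dense_continuous_hasCompactSupport :
    Dense {u : Lp A 1 μ | ∃ φ : G → A, Continuous φ ∧ HasCompactSupport φ ∧ u =ᵐ[μ] φ} := by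
  have key : ∀ (c : A) ⦃t : Set G⦄, MeasurableSet t → μ t < ∞ → ∀ {ε : ℝ≥0∞}, ε ≠ 0 →
      ∃ g : G → A, eLpNorm (g - t.indicator fun _ => c) 1 μ ≤ ε ∧
        Continuous g ∧ HasCompactSupport g := by
    intro c t ht htμ ε hε
    -- With `K ⊆ t`, `K ⊆ V` and a bump function equal to `1` on `K` and `0` off `V`, the error is
    -- bounded by `‖c‖` and lives on `(t \ K) ∪ (V \ K)`. Each piece gets measure at most `η / 2`.
    obtain ⟨η, hη0, hη⟩ := exists_eLpNorm_indicator_le (μ := μ) ENNReal.one_ne_top c hε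
    have hη0' : (η / 2 : ℝ≥0∞) ≠ 0 := by simpa using hη0.ne'
    obtain ⟨K, hKt, hK, hKc, hμK⟩ := ht.exists_isCompact_isClosed_sdiff_lt htμ.ne hη0'
    obtain ⟨V, hKV, hV, -, hμV⟩ := hKc.measurableSet.exists_isOpen_sdiff_lt
      (hK.measure_lt_top (μ := μ)).ne hη0'
    obtain ⟨g, hgK, hgV, hgs, hg⟩ := exists_continuous_one_zero_of_isCompact hK hV.isClosed_compl
      (Set.disjoint_compl_right_iff_subset.2 hKV)
    refine ⟨fun x => (g x : ℂ) • c, (eLpNorm_mono fun x => ?_).trans (hη ((t \ K) ∪ (V \ K)) ?_),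
      by fun_prop, ?_⟩
    · by_cases hxK : x ∈ K
      · have h1 : g x = 1 := hgK hxK
        simp [h1, hKt hxK]
      have hgn : ‖(g x : ℂ)‖ ≤ 1 := by
        rw [Complex.norm_real, Real.norm_of_nonneg (hg x).1]
        exact (hg x).2
      by_cases hxt : x ∈ t
      · have h1 : (g x : ℂ) • c - c = -((1 - (g x : ℂ)) • c) := by
          rw [sub_smul, one_smul, neg_sub]
        have h2 : ‖1 - (g x : ℂ)‖ ≤ 1 := by
          rw [← Complex.ofReal_one, ← Complex.ofReal_sub, Complex.norm_real,
            Real.norm_of_nonneg (sub_nonneg.2 (hg x).2)]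
          linarith [(hg x).1]
        simp only [Pi.sub_apply, Set.indicator_of_mem hxt, h1, norm_neg, norm_smul]
        rw [Set.indicator_of_mem (show x ∈ t \ K ∪ V \ K from Or.inl ⟨hxt, hxK⟩)]
        exact mul_le_of_le_one_left (norm_nonneg _) h2
      · simp only [Pi.sub_apply, Set.indicator_of_notMem hxt, sub_zero, norm_smul]
        by_cases hxV : x ∈ V
        · rw [Set.indicator_of_mem (show x ∈ t \ K ∪ V \ K from Or.inr ⟨hxV, hxK⟩)]
          exact mul_le_of_le_one_left (norm_nonneg _) hgn
        · have h1 : g x = 0 := hgV hxV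
          simp [h1]
    · refine (measure_union_le _ _).trans ((add_le_add hμK.le hμV.le).trans_eq ?_)
      exact ENNReal.add_halves _
    · refine hgs.mono' fun x hx => subset_tsupport _ fun h => hx ?_
      simp [h]
  refine fun u => EMetric.mem_closure_iff.2 fun ε hε => ?_
  -- The approximation below is only `≤ δ`, whereas density asks for `< ε`.
  obtain ⟨δ, hδ, hδε⟩ := exists_between hε
  obtain ⟨φ, hφ, hφc, hφs⟩ := (Lp.memLp u).induction_dense ENNReal.one_ne_top
    (fun φ : G → A => Continuous φ ∧ HasCompactSupport φ) key
    (fun f g hf hg => ⟨hf.1.add hg.1, hf.2.add hg.2⟩)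
    (fun f hf => (hf.1.integrable_of_hasCompactSupport hf.2).aestronglyMeasurable) hδ.ne'
  have hφm : MemLp φ 1 μ :=
    memLp_one_iff_integrable.2 (hφc.integrable_of_hasCompactSupport hφs)
  refine ⟨hφm.toLp φ, ⟨φ, hφc, hφs, hφm.coeFn_toLp⟩, ?_⟩
  rw [Lp.edist_def]
  refine lt_of_le_of_lt ?_ hδε
  rwa [eLpNorm_congr_ae (EventuallyEq.rfl.sub hφm.coeFn_toLp)]

/-- Integration over a set, as a continuous linear functional. -/
theorem exists_setIntegralCLM (S : Set G) :
    ∃ J : Lp A 1 μ →L[ℂ] A, ∀ u, J u = ∫ x in S, u x ∂μ := by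
  refine ⟨LinearMap.mkContinuous
    { toFun := fun u => ∫ x in S, u x ∂μ
      map_add' := fun u v => by
        rw [← integral_add (L1.integrable_coeFn u).integrableOn
          (L1.integrable_coeFn v).integrableOn]
        exact integral_congr_ae (ae_restrict_of_ae (Lp.coeFn_add u v))
      map_smul' := fun c u => by
        rw [RingHom.id_apply, ← integral_smul]
        exact integral_congr_ae (ae_restrict_of_ae (Lp.coeFn_smul c u)) } 1
    (fun u => ?_), fun u => rfl⟩
  rw [one_mul, L1.norm_eq_integral_norm]
  exact (norm_integral_le_integral_norm _).trans (setIntegral_le_integral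
    (L1.integrable_coeFn u).norm (Eventually.of_forall fun _ => norm_nonneg _))

variable [CompleteSpace A]

/-- A Bochner integral in `L¹(G, A)` with a continuous kernel of compact support is computed
pointwise. -/
theorem integral_Lp_ae_eq {k : G → G → A} (hk : Continuous k.uncurry)
    (hks : HasCompactSupport k.uncurry) {K : G → Lp A 1 μ} (hKi : Integrable K μ)
    (hK : ∀ᵐ y ∂μ, K y =ᵐ[μ] k y) :
    ⇑(∫ y, K y ∂μ) =ᵐ[μ] fun x => ∫ y, k y x ∂μ := by
  have hv : Integrable (fun x => ∫ y, k y x ∂μ) μ := by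
    refine Continuous.integrable_of_hasCompactSupport ?_ ?_
    · have h : ContinuousOn (fun x => ∫ y, k y x ∂μ) Set.univ := by
        refine continuousOn_integral_of_compact_support (hks.isCompact.image continuous_fst) ?_ ?_
        · exact (hk.comp continuous_swap).continuousOn
        · intro p x _ hx
          by_contra hne
          exact hx ⟨(x, p), subset_tsupport _ hne, rfl⟩
      exact continuousOn_univ.1 h
    · refine HasCompactSupport.intro (hks.isCompact.image continuous_snd) fun x hx => ?_
      refine integral_eq_zero_of_ae (Eventually.of_forall fun y => ?_)
      by_contra hy
      exact hx ⟨(y, x), subset_tsupport _ hy, rfl⟩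
  -- It suffices to compare integrals over sets of finite measure. Integration over `S` is a
  -- continuous functional, so it passes inside the vector integral; Fubini for compactly supported
  -- continuous kernels needs no σ-finiteness.
  refine Integrable.ae_eq_of_forall_setIntegral_eq _ _ (L1.integrable_coeFn _) hv
    fun S hS hμS => ?_
  obtain ⟨J, hJ⟩ := exists_setIntegralCLM (μ := μ) (A := A) S
  rw [← hJ, ← J.integral_comp_comm hKi, ← integral_integral_swap_of_hasCompactSupport hk hks]
  refine integral_congr_ae ?_
  filter_upwards [hK] with y hy
  rw [hJ]
  exact integral_congr_ae (ae_restrict_of_ae hy)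

/-- For continuous functions of compact support both sides are pointwise integrals related by `y ↦
y⁻¹`, which preserves `μ` by unimodularity. Both products are jointly bounded, so density in each
variable gives the general case. -/
theorem conv_eq_rconv [μ.IsMulRightInvariant] (f g : Lp A 1 μ) : conv f g = rconv f g := by
  have : μ.IsInvInvariant := isInvInvariant_of_isMulRightInvariant μ
  suffices h : ∀ f ∈ {u : Lp A 1 μ | ∃ φ : G → A, Continuous φ ∧ HasCompactSupport φ ∧ u =ᵐ[μ] φ},
      ∀ g ∈ {u : Lp A 1 μ | ∃ φ : G → A, Continuous φ ∧ HasCompactSupport φ ∧ u =ᵐ[μ] φ},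
      conv f g = rconv f g by
    have hd := dense_continuous_hasCompactSupport (μ := μ) (A := A)
    have h1 : ∀ g ∈ {u : Lp A 1 μ | ∃ φ : G → A, Continuous φ ∧ HasCompactSupport φ ∧ u =ᵐ[μ] φ},
        ∀ f, convL f g = rconvL f g := fun g hg f =>
      congrFun (((convL (μ := μ) (A := A)).flip g).continuous.ext_on hd
        ((rconvL (μ := μ) (A := A)).flip g).continuous
        fun f hf => h f hf g hg) f
    exact congrFun ((convL f).continuous.ext_on hd (rconvL f).continuous
      fun g hg => h1 g hg f) g
  rintro f ⟨φ, hφ, hφs, hfφ⟩ g ⟨ψ, hψ, hψs, hgψ⟩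
  refine Lp.ext ((conv_ae_eq (μ := μ) hφ hφs hψ hψs f g hfφ hgψ).trans ?_)
  have hk : Continuous (Function.uncurry fun y x : G => φ (x * y⁻¹) * ψ y) := by
    unfold Function.uncurry
    fun_prop
  have hks : HasCompactSupport (Function.uncurry fun y x : G => φ (x * y⁻¹) * ψ y) := by
    -- The kernel is nonzero at `(y, x)` only if `y ∈ supp ψ` and `x y⁻¹ ∈ supp φ`, that is, on the
    -- image of `supp ψ × supp φ` under `(a, b) ↦ (a, b a)`.
    refine HasCompactSupport.intro (K := (fun p : G × G => (p.1, p.2 * p.1)) ''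
      (tsupport ψ ×ˢ tsupport φ)) ((hψs.isCompact.prod hφs.isCompact).image (by fun_prop)) ?_
    rintro ⟨a, b⟩ hab
    by_contra hne
    refine hab ⟨(a, b * a⁻¹), ⟨subset_tsupport _ fun h => hne ?_,
      subset_tsupport _ fun h => hne ?_⟩, by simp⟩
    · simp [Function.uncurry, h]
    · simp only [] at h
      simp [Function.uncurry, h]
  have hr := integral_Lp_ae_eq hk hks (integrable_rconv f g) ?_
  · refine EventuallyEq.trans (Eventually.of_forall fun x => ?_) hr.symm
    dsimp only
    rw [← integral_inv_eq_self]
    simp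
  · filter_upwards [hgψ] with y hy
    have h := (measurePreserving_mul_right μ y⁻¹).quasiMeasurePreserving.ae_eq_comp hfφ
    filter_upwards [rightMul_ae (g y) (rtranslate y⁻¹ f), rtranslate_ae y⁻¹ f, h] with x h1 h2 h3
    rw [h1, h2, hy]
    exact congrArg (· * ψ y) h3

end GroupAlg

/-! ### The centre of `L¹(G, A)` -/

section Continuous

variable {G : Type*} [Group G] [TopologicalSpace G]
  [LocallyCompactSpace G] [T2Space G] [MeasurableSpace G] [BorelSpace G]
  {μ : Measure G} [μ.IsHaarMeasure]

/-- A continuous function whose integrals over compact sets vanish is zero. -/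
theorem Continuous.eq_zero_of_forall_setIntegral_isCompact {N : Type*} [NormedAddCommGroup N]
    [NormedSpace ℝ N] [CompleteSpace N] {F : G → N} (hF : Continuous F)
    (h : ∀ K, IsCompact K → ∫ y in K, F y ∂μ = 0) (t : G) : F t = 0 := by
  by_contra hne
  have hpos : 0 < ‖F t‖ / 2 := half_pos (norm_pos_iff.2 hne)
  -- On `K` the function stays within `‖F t‖ / 2` of `F t`, so a vanishing integral would give `‖F
  -- t‖ μ(K) ≤ ‖F t‖ μ(K) / 2`.
  obtain ⟨K, hKt, hKU, hK⟩ := local_compact_nhds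
    (hF.continuousAt.preimage_mem_nhds (Metric.ball_mem_nhds (F t) hpos))
  have hμ0 : 0 < μ.real K :=
    ENNReal.toReal_pos (Measure.measure_pos_of_mem_nhds μ hKt).ne' hK.measure_lt_top.ne
  have h1 : ‖∫ y in K, (F y - F t) ∂μ‖ ≤ ‖F t‖ / 2 * μ.real K :=
    norm_setIntegral_le_of_norm_le_const hK.measure_lt_top fun y hy =>
      (mem_ball_iff_norm.1 (hKU hy)).le
  rw [integral_sub (hF.continuousOn.integrableOn_compact hK)
    (integrableOn_const hK.measure_lt_top.ne), h K hK, zero_sub, norm_neg,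
    setIntegral_const, norm_smul, Real.norm_of_nonneg hμ0.le] at h1
  nlinarith

end Continuous

theorem NonUnitalSubalgebra.isClosed_center {A : Type*} [NonUnitalNormedRing A] [NormedSpace ℂ A]
    [IsScalarTower ℂ A A] [SMulCommClass ℂ A A] :
    IsClosed ((NonUnitalSubalgebra.center ℂ A : NonUnitalSubalgebra ℂ A) : Set A) := by
  have h : ((NonUnitalSubalgebra.center ℂ A : NonUnitalSubalgebra ℂ A) : Set A) =
      ⋂ a : A, {z | a * z = z * a} := by
    ext z
    simp only [Set.mem_iInter, Set.mem_ofPred_eq]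
    exact Semigroup.mem_center_iff
  rw [h]
  exact isClosed_iInter fun a => isClosed_eq (by fun_prop) (by fun_prop)

theorem NonUnitalSubalgebra.mem_center_iff_forall_mul {A : Type*} [NonUnitalNormedRing A]
    [NormedSpace ℂ A] [IsScalarTower ℂ A A] [SMulCommClass ℂ A A] {z : A} :
    z ∈ NonUnitalSubalgebra.center ℂ A ↔ ∀ a, a * z = z * a :=
  Semigroup.mem_center_iff

/-- An integrable function is almost everywhere in a closed subspace that contains its integrals
over sets of finite measure. -/
theorem MeasureTheory.Integrable.ae_mem_of_forall_setIntegral_mem {X : Type*}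
    {mX : MeasurableSpace X}
    {μ : Measure X} {N : Type*} [NormedAddCommGroup N] [NormedSpace ℝ N] [CompleteSpace N]
    {f : X → N} (hf : Integrable f μ) (Z : Submodule ℝ N) (hZ : IsClosed (Z : Set N))
    (h : ∀ S, MeasurableSet S → μ S < ∞ → ∫ x in S, f x ∂μ ∈ Z) : ∀ᵐ x ∂μ, f x ∈ Z := by
  have : IsClosed (Z : Set N) := hZ
  -- Modulo `Z` every set integral vanishes, so the class of `f` in the quotient Banach space is
  -- zero almost everywhere.
  have h0 : (fun x => Z.mkQL (f x)) =ᵐ[μ] 0 := by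
    refine Integrable.ae_eq_zero_of_forall_setIntegral_eq_zero (Z.mkQL.integrable_comp hf)
      fun S hS hμS => ?_
    rw [Z.mkQL.integral_comp_comm hf.integrableOn]
    exact (Submodule.Quotient.mk_eq_zero Z).2 (h S hS hμS)
  filter_upwards [h0] with x hx
  exact (Submodule.Quotient.mk_eq_zero Z).1 hx

namespace GroupAlg

set_option linter.unusedSectionVars false

variable {G : Type*} [Group G] [TopologicalSpace G] [IsTopologicalGroup G]
  [LocallyCompactSpace G] [MeasurableSpace G] [BorelSpace G]
  {μ : Measure G} [μ.IsHaarMeasure] [μ.Regular]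
  {A : Type*} [NonUnitalNormedRing A] [NormedSpace ℂ A] [IsScalarTower ℂ A A]
  [SMulCommClass ℂ A A]

theorem translate_rightMul (y : G) (a : A) (g : Lp A 1 μ) :
    translate y (rightMul μ A a g) = rightMul μ A a (translate y g) := by
  apply Lp.ext
  have h := (measurePreserving_mul_left μ y⁻¹).quasiMeasurePreserving.ae_eq_comp
    (rightMul_ae (μ := μ) a g)
  filter_upwards [translate_ae y (rightMul μ A a g), rightMul_ae a (translate y g),
    translate_ae y g, h] with x h1 h2 h3 h4
  rw [h1, h2, h3]
  exact h4

theorem translate_one (g : Lp A 1 μ) : translate 1 g = g := by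
  apply Lp.ext
  filter_upwards [translate_ae 1 g] with x h
  rw [h, inv_one, one_mul]

theorem leftMul_eq_rightMul_of_ae_mem_center {f : Lp A 1 μ}
    (hf : ∀ᵐ x ∂μ, f x ∈ NonUnitalSubalgebra.center ℂ A) (a : A) :
    leftMul μ A a f = rightMul μ A a f := by
  apply Lp.ext
  filter_upwards [leftMul_ae a f, rightMul_ae a f, hf] with x h1 h2 h3
  rw [h1, h2, NonUnitalSubalgebra.mem_center_iff_forall_mul.1 h3]

variable [CompleteSpace A]

theorem setIntegral_leftMul (a : A) (f : Lp A 1 μ) (S : Set G) :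
    ∫ x in S, leftMul μ A a f x ∂μ = a * ∫ x in S, f x ∂μ := by
  rw [← ContinuousLinearMap.mul_apply' ℂ A a,
    ← (ContinuousLinearMap.mul ℂ A a).integral_comp_comm (L1.integrable_coeFn f).integrableOn]
  exact integral_congr_ae (ae_restrict_of_ae (leftMul_ae a f))

theorem setIntegral_rightMul (a : A) (f : Lp A 1 μ) (S : Set G) :
    ∫ x in S, rightMul μ A a f x ∂μ = (∫ x in S, f x ∂μ) * a := by
  have h := ((ContinuousLinearMap.mul ℂ A).flip a).integral_comp_comm
    (L1.integrable_coeFn f).integrableOn (μ := μ.restrict S)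
  exact (integral_congr_ae (ae_restrict_of_ae (rightMul_ae a f))).trans h

theorem setIntegral_mem_center {f : Lp A 1 μ} (hf : ∀ a, leftMul μ A a f = rightMul μ A a f)
    (S : Set G) : ∫ x in S, f x ∂μ ∈ NonUnitalSubalgebra.center ℂ A :=
  NonUnitalSubalgebra.mem_center_iff_forall_mul.2 fun a => by
    rw [← setIntegral_leftMul, ← setIntegral_rightMul, hf]

/-- For each `a` the equation `a f(x) = f(x) a` holds off a null set depending on `a`, and `A` may
be nonseparable. Set integrals of `f` avoid this: they commute with every `a`, and the centre is
closed. -/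
theorem ae_mem_center {f : Lp A 1 μ} (hf : ∀ a, leftMul μ A a f = rightMul μ A a f) :
    ∀ᵐ x ∂μ, f x ∈ NonUnitalSubalgebra.center ℂ A :=
  (L1.integrable_coeFn f).ae_mem_of_forall_setIntegral_mem
    ((NonUnitalSubalgebra.center ℂ A).toSubmodule.restrictScalars ℝ)
    NonUnitalSubalgebra.isClosed_center fun S _ _ => setIntegral_mem_center hf S

/-- With a `Z(A)`-approximate identity, a central-valued function annihilated by `A` is zero. -/
theorem eq_zero_of_forall_leftMul_eq_zero {ι : Type*} [Preorder ι] [IsDirectedOrder ι] [Nonempty ι]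
    {a : ι → A} (ha : IsBoundedCenterApproxIdentity a) {h : Lp A 1 μ}
    (hc : ∀ a, leftMul μ A a h = rightMul μ A a h) (h0 : ∀ a, leftMul μ A a h = 0) : h = 0 := by
  -- The approximate identity acts on elements of `Z(A)`, so it is applied to the integrals of `h`
  -- rather than to its values.
  have hS : ∀ S : Set G, ∫ x in S, h x ∂μ = 0 := fun S => by
    have hlim := ha.2 _ (setIntegral_mem_center hc S)
    have hz : ∀ i, a i * ∫ x in S, h x ∂μ = 0 := fun i => by
      rw [← setIntegral_leftMul, h0]
      exact integral_eq_zero_of_ae (ae_restrict_of_ae (Lp.coeFn_zero A 1 μ))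
    simp only [hz] at hlim
    exact tendsto_nhds_unique hlim tendsto_const_nhds
  refine (Lp.eq_zero_iff_ae_eq_zero).2 ?_
  exact (L1.integrable_coeFn h).ae_eq_zero_of_forall_setIntegral_eq_zero fun S _ _ => hS S

theorem conv_indicatorConstLp {S : Set G} (hS : MeasurableSet S) (hμS : μ S ≠ ∞) (a : A)
    (f : Lp A 1 μ) :
    conv (indicatorConstLp 1 hS hμS a) f = ∫ y in S, leftMul μ A a (translate y f) ∂μ := by
  rw [conv, ← integral_indicator hS]
  refine integral_congr_ae ?_
  filter_upwards [indicatorConstLp_coeFn (p := 1) (hs := hS) (hμs := hμS) (c := a)] with y hy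
  rw [hy]
  by_cases h : y ∈ S <;> simp [h]

theorem rconv_indicatorConstLp [μ.IsMulRightInvariant] {S : Set G} (hS : MeasurableSet S)
    (hμS : μ S ≠ ∞) (a : A) (f : Lp A 1 μ) :
    rconv f (indicatorConstLp 1 hS hμS a) =
      ∫ y in S, rightMul μ A a (rtranslate y⁻¹ f) ∂μ := by
  rw [rconv, ← integral_indicator hS]
  refine integral_congr_ae ?_
  filter_upwards [indicatorConstLp_coeFn (p := 1) (hs := hS) (hμs := hμS) (c := a)] with y hy
  rw [hy]
  by_cases h : y ∈ S <;> simp [h]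

theorem mem_center_iff {f : GroupAlg μ A} :
    f ∈ NonUnitalSubalgebra.center ℂ (GroupAlg μ A) ↔
      ∀ g : Lp A 1 μ, conv g f.toLp = conv f.toLp g :=
  NonUnitalSubalgebra.mem_center_iff_forall_mul

/-! ### Centrality as a condition on left and right translates. -/

variable [μ.IsMulRightInvariant]

/-- Written as integrals of translates of `f` weighted by `g(y)`, the products `g * f` and `f * g`
have the same integrand. -/
theorem mem_center_of_translate_eq {f : GroupAlg μ A}
    (h1 : ∀ a, leftMul μ A a f.toLp = rightMul μ A a f.toLp)
    (h2 : ∀ y, translate y f.toLp = rtranslate y⁻¹ f.toLp) :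
    f ∈ NonUnitalSubalgebra.center ℂ (GroupAlg μ A) := by
  refine mem_center_iff.2 fun g => ?_
  rw [conv_eq_rconv f.toLp g, conv, rconv]
  congr 1
  ext1 y
  rw [← translate_leftMul, h1, translate_rightMul, h2]

/-- Commuting with `1_K a` says that two continuous functions of `y` have the same integral over
`K`. Letting `K` range over all compact sets gives equality at every point. -/
theorem leftMul_translate_of_mem_center [T2Space G] {f : GroupAlg μ A}
    (hf : f ∈ NonUnitalSubalgebra.center ℂ (GroupAlg μ A)) (a : A) (t : G) :
    leftMul μ A a (translate t f.toLp) = rightMul μ A a (rtranslate t⁻¹ f.toLp) := by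
  have hc1 : Continuous fun y => leftMul μ A a (translate y f.toLp) :=
    (leftMul μ A a).continuous.comp (continuous_translate f.toLp)
  have hc2 : Continuous fun y : G => rightMul μ A a (rtranslate y⁻¹ f.toLp) :=
    (rightMul μ A a).continuous.comp ((continuous_rtranslate f.toLp).comp continuous_inv)
  refine sub_eq_zero.1 (Continuous.eq_zero_of_forall_setIntegral_isCompact (μ := μ)
    (hc1.sub hc2) (fun K hK => ?_) t)
  simp only [Pi.sub_apply]
  rw [integral_sub (hc1.continuousOn.integrableOn_compact hK)
    (hc2.continuousOn.integrableOn_compact hK),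
    ← conv_indicatorConstLp hK.measurableSet hK.measure_lt_top.ne,
    ← rconv_indicatorConstLp hK.measurableSet hK.measure_lt_top.ne,
    ← conv_eq_rconv, mem_center_iff.1 hf, sub_self]

theorem leftMul_eq_rightMul_of_mem_center [T2Space G] {f : GroupAlg μ A}
    (hf : f ∈ NonUnitalSubalgebra.center ℂ (GroupAlg μ A)) (a : A) :
    leftMul μ A a f.toLp = rightMul μ A a f.toLp := by
  have h := leftMul_translate_of_mem_center hf a 1
  rw [translate_one] at h
  rw [h]
  congr 1
  apply Lp.ext
  filter_upwards [rtranslate_ae (1 : G)⁻¹ f.toLp] with x hx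
  rw [hx, inv_one, mul_one]

/-- Both translates have values in `Z(A)`, so the localised identity says that `A` annihilates their
difference, which therefore vanishes. -/
theorem translate_eq_of_mem_center [T2Space G]
    {ι : Type*} [Preorder ι] [IsDirectedOrder ι] [Nonempty ι]
    {a : ι → A} (ha : IsBoundedCenterApproxIdentity a) {f : GroupAlg μ A}
    (hf : f ∈ NonUnitalSubalgebra.center ℂ (GroupAlg μ A)) (t : G) :
    translate t f.toLp = rtranslate t⁻¹ f.toLp := by
  have hc := ae_mem_center (leftMul_eq_rightMul_of_mem_center hf)
  have hl : ∀ a, leftMul μ A a (translate t f.toLp) = rightMul μ A a (translate t f.toLp) :=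
    fun a => by
      rw [← translate_leftMul, leftMul_eq_rightMul_of_mem_center hf, translate_rightMul]
  have hr : ∀ a, leftMul μ A a (rtranslate t⁻¹ f.toLp) = rightMul μ A a (rtranslate t⁻¹ f.toLp) :=
    leftMul_eq_rightMul_of_ae_mem_center (by
      filter_upwards [rtranslate_ae t⁻¹ f.toLp,
        (measurePreserving_mul_right μ t⁻¹).quasiMeasurePreserving.ae hc] with x h1 h2
      rwa [h1])
  refine sub_eq_zero.1 (eq_zero_of_forall_leftMul_eq_zero ha (fun a => ?_) fun a => ?_)
  · rw [map_sub, map_sub, hl, hr]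
  · rw [map_sub, leftMul_translate_of_mem_center hf, hr, sub_self]

/-- A central function is invariant under inner automorphisms. -/
theorem conj_ae_eq_of_mem_center [T2Space G]
    {ι : Type*} [Preorder ι] [IsDirectedOrder ι] [Nonempty ι]
    {a : ι → A} (ha : IsBoundedCenterApproxIdentity a) {f : GroupAlg μ A}
    (hf : f ∈ NonUnitalSubalgebra.center ℂ (GroupAlg μ A)) (t : G) :
    (fun x => f.toLp (t * x * t⁻¹)) =ᵐ[μ] f.toLp := by
  have h1 := translate_ae t⁻¹ f.toLp
  rw [translate_eq_of_mem_center ha hf, inv_inv] at h1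
  have h2 := (rtranslate_ae t f.toLp).symm.trans h1
  -- The relation `f(x t) = f(t x)` is evaluated at `x t⁻¹`.
  filter_upwards [(measurePreserving_mul_right μ t⁻¹).quasiMeasurePreserving.ae h2] with x hx
  rw [inv_mul_cancel_right] at hx
  rw [hx, mul_assoc]

end GroupAlg

/-! ### The `σ`-algebra of sets invariant under inner automorphisms -/

namespace GroupAlg

set_option linter.unusedSectionVars false

/-- A closed additive property of `L¹` functions that holds for indicators holds everywhere. -/
theorem Lp_one_induction {X : Type*} {mX : MeasurableSpace X} {ν : Measure X} {N : Type*}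
    [NormedAddCommGroup N] {P : Lp N 1 ν → Prop} (hP : IsClosed {u | P u})
    (h_ind : ∀ (c : N) (s : Set X) (hs : MeasurableSet s) (hμs : ν s ≠ ∞),
      P (indicatorConstLp 1 hs hμs c))
    (h_add : ∀ u v, P u → P v → P (u + v)) (u : Lp N 1 ν) : P u := by
  induction u using Lp.induction ENNReal.one_ne_top with
  | indicatorConst c hs hμs => exact h_ind c _ hs hμs.ne
  | add hf hg _ h1 h2 => exact h_add _ _ h1 h2
  | isClosed => exact hP

/-- The `σ`-algebra of measurable sets that are almost invariant under every inner automorphism. -/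
@[reducible] def conjInvariant {G : Type*} [Group G] [MeasurableSpace G] (μ : Measure G) :
    MeasurableSpace G where
  MeasurableSet' S := MeasurableSet S ∧ ∀ y : G, (fun x => y * x * y⁻¹) ⁻¹' S =ᵐ[μ] S
  measurableSet_empty := ⟨MeasurableSet.empty, fun _ => EventuallyEq.rfl⟩
  measurableSet_compl S hS := ⟨hS.1.compl, fun y => (hS.2 y).compl⟩
  measurableSet_iUnion S hS := ⟨MeasurableSet.iUnion fun i => (hS i).1, fun y => by
    rw [Set.preimage_iUnion]
    exact Filter.EventuallyEq.countable_iUnion fun i => (hS i).2 y⟩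

theorem conjInvariant_le {G : Type*} [Group G] [m : MeasurableSpace G] (μ : Measure G) :
    conjInvariant μ ≤ m := fun _ hS => hS.1

/-- Invariance of sets up to a null set, possibly depending on `y`, is exactly what preimages under
`f` satisfy; no strictly invariant representative has to be found. -/
theorem stronglyMeasurable_conjInvariant {G : Type*} [Group G] [MeasurableSpace G] {μ : Measure G}
    {N : Type*} [NormedAddCommGroup N] {f : G → N} (hf : StronglyMeasurable f)
    (h : ∀ y : G, (fun x => f (y * x * y⁻¹)) =ᵐ[μ] f) :
    StronglyMeasurable[conjInvariant μ] f := by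
  borelize N
  refine stronglyMeasurable_iff_measurable_separable.2 ⟨fun U hU =>
    ⟨hf.measurable hU, fun y => ?_⟩,
    hf.isSeparable_range⟩
  exact (h y).preimage U

variable {G : Type*} [Group G] [TopologicalSpace G] [IsTopologicalGroup G]
  [LocallyCompactSpace G] [MeasurableSpace G] [BorelSpace G]
  {μ : Measure G} [μ.IsHaarMeasure] [μ.Regular]
  {A : Type*} [NonUnitalNormedRing A] [NormedSpace ℂ A] [IsScalarTower ℂ A A]
  [SMulCommClass ℂ A A]

/-- The inclusion of the `L¹`-space of the conjugation invariant `σ`-algebra into `L¹(G, A)`. -/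
theorem exists_trim_inclusion {E : Type*} [NormedAddCommGroup E] [NormedSpace ℂ E]
    (j : E →ₗᵢ[ℂ] A) :
    ∃ T : Lp E 1 (μ.trim (conjInvariant_le μ)) →ₗᵢ[ℂ] Lp A 1 μ,
      ∀ u, T u =ᵐ[μ] fun x => j (u x) := by
  -- `L¹` of the trimmed measure is the subspace of classes having a representative measurable for
  -- the smaller σ-algebra.
  let L : Lp E 1 (μ.trim (conjInvariant_le μ)) →ₗᵢ[ℂ] Lp E 1 μ :=
    (lpMeas E ℂ (conjInvariant μ) 1 μ).subtypeₗᵢ.comp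
      (lpMeasToLpTrimLie E ℂ 1 μ (conjInvariant_le μ)).symm.toLinearIsometry
  have hL : ∀ u, L u =ᵐ[μ] u := fun u => lpTrimToLpMeas_ae_eq (𝕜 := ℂ) (conjInvariant_le μ) u
  let J : Lp E 1 μ →L[ℂ] Lp A 1 μ := j.toContinuousLinearMap.compLpL 1 μ
  have hJ : ∀ v, J v =ᵐ[μ] fun x => j (v x) := fun v => j.toContinuousLinearMap.coeFn_compLp v
  refine ⟨⟨(J : Lp E 1 μ →ₗ[ℂ] Lp A 1 μ) ∘ₗ L.toLinearMap, fun u => ?_⟩, fun u => ?_⟩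
  · change ‖J (L u)‖ = ‖u‖
    rw [← L.norm_map u, L1.norm_eq_integral_norm, L1.norm_eq_integral_norm]
    refine integral_congr_ae ?_
    filter_upwards [hJ (L u)] with x hx
    rw [hx, j.norm_map]
  · change J (L u) =ᵐ[μ] _
    filter_upwards [hJ (L u), hL u] with x h1 h2
    rw [h1, h2]

variable [CompleteSpace A] [μ.IsMulRightInvariant]

theorem indicatorConstLp_mem_center {S : Set G} (hS : MeasurableSet[conjInvariant μ] S)
    {z : A} (hz : z ∈ NonUnitalSubalgebra.center ℂ A) {f : GroupAlg μ A}
    (hf : f.toLp =ᵐ[μ] S.indicator fun _ => z) :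
    f ∈ NonUnitalSubalgebra.center ℂ (GroupAlg μ A) := by
  refine mem_center_of_translate_eq (leftMul_eq_rightMul_of_ae_mem_center ?_) fun y => ?_
  · filter_upwards [hf] with x hx
    rw [hx]
    by_cases h : x ∈ S
    · rwa [Set.indicator_of_mem h]
    · rw [Set.indicator_of_notMem h]
      exact zero_mem _
  · apply Lp.ext
    have h1 := (measurePreserving_mul_left μ y⁻¹).quasiMeasurePreserving.ae_eq_comp hf
    have h2 := (measurePreserving_mul_right μ y⁻¹).quasiMeasurePreserving.ae_eq_comp hf
    have h3 := (measurePreserving_mul_right μ y⁻¹).quasiMeasurePreserving.ae_eq_comp (hS.2 y⁻¹)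
    filter_upwards [translate_ae y f.toLp, rtranslate_ae y⁻¹ f.toLp, h1, h2, h3]
      with x e1 e2 e3 e4 e5
    -- Almost invariance under conjugation by `y⁻¹`, evaluated at `x y⁻¹`, compares exactly the two
    -- translates.
    have e6 : (y⁻¹ * x ∈ S) = (x * y⁻¹ ∈ S) := by
      have : (y⁻¹ * (x * y⁻¹) * y⁻¹⁻¹ ∈ S) = (x * y⁻¹ ∈ S) := e5
      rw [← this]
      congr 1
      group
    simp only [Function.comp_apply] at e3 e4
    rw [e1, e2, e3, e4]
    by_cases h : x * y⁻¹ ∈ S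
    · rw [Set.indicator_of_mem h, Set.indicator_of_mem (e6.mpr h)]
    · rw [Set.indicator_of_notMem h, Set.indicator_of_notMem fun h' => h (e6.mp h')]

/-- The centre of `L¹(G, A)` is the space of conjugation invariant integrable functions with
values in the centre of `A`. -/
theorem exists_center_equiv [T2Space G]
    {ι : Type*} [Preorder ι] [IsDirectedOrder ι] [Nonempty ι]
    {a : ι → A} (ha : IsBoundedCenterApproxIdentity a)
    {E : Type*} [NormedAddCommGroup E] [NormedSpace ℂ E] (j : E →ₗᵢ[ℂ] A)
    (hj : ∀ z, z ∈ NonUnitalSubalgebra.center ℂ A ↔ ∃ e, j e = z) :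
    ∃ e : NonUnitalSubalgebra.center ℂ (GroupAlg μ A) ≃ₗᵢ[ℂ]
        Lp E 1 (μ.trim (conjInvariant_le μ)),
      ∀ f : NonUnitalSubalgebra.center ℂ (GroupAlg μ A),
        (f : GroupAlg μ A).toLp =ᵐ[μ] fun x => j (e f x) := by
  obtain ⟨T, hT⟩ := exists_trim_inclusion (μ := μ) j
  -- The centre is a closed subspace, so indicators of almost invariant sets with central values
  -- suffice.
  have hTc : ∀ u, (T u : GroupAlg μ A) ∈ NonUnitalSubalgebra.center ℂ (GroupAlg μ A) := by
    refine Lp_one_induction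
      ((NonUnitalSubalgebra.isClosed_center (A := GroupAlg μ A)).preimage T.continuous)
      (fun c s hs hμs => ?_) fun u v hu hv => ?_
    · refine indicatorConstLp_mem_center hs ((hj (j c)).2 ⟨c, rfl⟩) ((hT _).trans ?_)
      filter_upwards [ae_eq_of_ae_eq_trim (hm := conjInvariant_le μ) (indicatorConstLp_coeFn
        (p := 1) (hs := hs) (hμs := hμs) (c := c))] with x hx
      rw [hx]
      by_cases h : x ∈ s <;> simp [h]
    · rw [map_add]
      exact add_mem (S := NonUnitalSubalgebra ℂ (GroupAlg μ A)) hu hv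
  let T' : Lp E 1 (μ.trim (conjInvariant_le μ)) →ₗᵢ[ℂ]
      NonUnitalSubalgebra.center ℂ (GroupAlg μ A) :=
    { toFun := fun u => ⟨T u, hTc u⟩
      map_add' := fun u v => Subtype.ext (T.map_add u v)
      map_smul' := fun c u => Subtype.ext (T.map_smul c u)
      norm_map' := fun u => T.norm_map u }
  have hsurj : Function.Surjective T' := by
    rintro ⟨f, hf⟩
    have hfc := ae_mem_center (leftMul_eq_rightMul_of_mem_center hf)
    have hfi := conj_ae_eq_of_mem_center ha hf
    let Z : Set A := (NonUnitalSubalgebra.center ℂ A : NonUnitalSubalgebra ℂ A)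
    have hfm : StronglyMeasurable f.toLp := Lp.stronglyMeasurable f.toLp
    have hZm : MeasurableSet (f.toLp ⁻¹' Z) := by
      borelize A
      exact hfm.measurable NonUnitalSubalgebra.isClosed_center.measurableSet
    -- Setting `f` to zero off `f⁻¹(Z(A))` makes every value central, so that it lifts through `j`
    -- pointwise; the set is measurable because the centre is closed.
    let g : G → A := (f.toLp ⁻¹' Z).indicator f.toLp
    have hgf : g =ᵐ[μ] f.toLp := by
      filter_upwards [hfc] with x hx
      exact Set.indicator_of_mem (show x ∈ f.toLp ⁻¹' Z from hx) _
    have hgm : StronglyMeasurable[conjInvariant μ] g := by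
      refine stronglyMeasurable_conjInvariant (hfm.indicator hZm) fun y => ?_
      have hmp : MeasurePreserving (fun x => y * x * y⁻¹) μ μ :=
        (measurePreserving_mul_right μ y⁻¹).comp (measurePreserving_mul_left μ y)
      exact (hmp.quasiMeasurePreserving.ae_eq_comp hgf).trans ((hfi y).trans hgf.symm)
    have hgE : ∀ x, ∃ e, j e = g x := fun x => (hj (g x)).1 (by
      by_cases h : x ∈ f.toLp ⁻¹' Z
      · rw [show g x = f.toLp x from Set.indicator_of_mem h _]
        exact h
      · rw [show g x = 0 from Set.indicator_of_notMem h _]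
        exact zero_mem _)
    choose gE hgE using hgE
    have hgEm : StronglyMeasurable[conjInvariant μ] gE := by
      -- The lift is chosen pointwise, yet it is measurable because `j` is a topological embedding.
      refine (Embedding.comp_stronglyMeasurable_iff j.isometry.isEmbedding).1 ?_
      simpa only [hgE] using hgm
    have hgi : Integrable gE μ := by
      refine ((L1.integrable_coeFn f.toLp).congr hgf.symm).mono
        (hgEm.mono (conjInvariant_le μ)).aestronglyMeasurable (Eventually.of_forall fun x => ?_)
      rw [← j.norm_map, hgE]
    have hgL : MemLp gE 1 (μ.trim (conjInvariant_le μ)) :=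
      memLp_one_iff_integrable.2 (hgi.trim (conjInvariant_le μ) hgEm)
    refine ⟨hgL.toLp gE, Subtype.ext (Lp.ext ((hT _).trans ?_))⟩
    filter_upwards [ae_eq_of_ae_eq_trim hgL.coeFn_toLp, hgf] with x h1 h2
    rw [h1, hgE, h2]
    rfl
  refine ⟨(LinearIsometryEquiv.ofSurjective T' hsurj).symm, fun f => ?_⟩
  have h := hT ((LinearIsometryEquiv.ofSurjective T' hsurj).symm f)
  have h' : T ((LinearIsometryEquiv.ofSurjective T' hsurj).symm f) = (f : GroupAlg μ A).toLp :=
    congrArg Subtype.val ((LinearIsometryEquiv.ofSurjective T' hsurj).apply_symm_apply f)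
  rwa [h'] at h

end GroupAlg

/-! ### The main theorem -/

/-- A continuous additive map is multiplicative as soon as it is so on elementary tensors. -/
theorem ProjTensor.map_mul_of_tmul {E F N : Type*}
    [NonUnitalNormedRing E] [NormedSpace ℂ E] [IsScalarTower ℂ E E] [SMulCommClass ℂ E E]
    [NonUnitalNormedRing F] [NormedSpace ℂ F] [IsScalarTower ℂ F F] [SMulCommClass ℂ F F]
    [NonUnitalNormedRing N] {Φ : ProjTensor E F → N} (hc : Continuous Φ) (h0 : Φ 0 = 0)
    (hadd : ∀ u v, Φ (u + v) = Φ u + Φ v)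
    (h : ∀ f g z w, Φ (tmul f z * tmul g w) = Φ (tmul f z) * Φ (tmul g w)) (u v : ProjTensor E F) :
    Φ (u * v) = Φ u * Φ v := by
  refine ProjTensor.induction (P := fun u => Φ (u * v) = Φ u * Φ v)
    (isClosed_eq (hc.comp (continuous_id.mul continuous_const)) (hc.mul continuous_const))
    (by rw [zero_mul, h0, zero_mul]) (fun f z => ?_)
    (fun u u' hu hu' => by rw [add_mul, hadd, hu, hu', hadd, add_mul]) u
  exact ProjTensor.induction (P := fun v => Φ (tmul f z * v) = Φ (tmul f z) * Φ v)
    (isClosed_eq (hc.comp (continuous_const.mul continuous_id)) (continuous_const.mul hc))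
    (by rw [mul_zero, h0, mul_zero]) (fun g w => h f g z w)
    (fun u u' hu hu' => by rw [mul_add, hadd, hu, hu', hadd, mul_add]) v

namespace GroupAlg

set_option linter.unusedSectionVars false

variable {G : Type*} [Group G] [TopologicalSpace G] [IsTopologicalGroup G]
  [LocallyCompactSpace G] [MeasurableSpace G] [BorelSpace G]
  {μ : Measure G} [μ.IsHaarMeasure] [μ.Regular]
  {A : Type*} [NonUnitalNormedRing A] [NormedSpace ℂ A] [IsScalarTower ℂ A A]
  [SMulCommClass ℂ A A]

variable (μ) in
/-- The map `f ↦ f(·) z` from `L¹(G)` to `L¹(G, A)`. -/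
noncomputable def smulVec (z : A) : Lp ℂ 1 μ →L[ℂ] Lp A 1 μ :=
  (ContinuousLinearMap.toSpanSingleton ℂ z).compLpL 1 μ

theorem smulVec_ae (z : A) (f : Lp ℂ 1 μ) : smulVec μ z f =ᵐ[μ] fun x => f x • z :=
  (ContinuousLinearMap.toSpanSingleton ℂ z).coeFn_compLp f

theorem translate_smulVec (y : G) (z : A) (f : Lp ℂ 1 μ) :
    translate y (smulVec μ z f) = smulVec μ z (translate y f) := by
  apply Lp.ext
  have h := (measurePreserving_mul_left μ y⁻¹).quasiMeasurePreserving.ae_eq_comp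
    (smulVec_ae (μ := μ) z f)
  filter_upwards [translate_ae y (smulVec μ z f), smulVec_ae z (translate y f),
    translate_ae y f, h] with x h1 h2 h3 h4
  rw [h1, h2, h3]
  exact h4

theorem leftMul_smulVec (c : ℂ) (z w : A) (f : Lp ℂ 1 μ) :
    leftMul μ A (c • z) (smulVec μ w f) = smulVec μ (z * w) (leftMul μ ℂ c f) := by
  apply Lp.ext
  filter_upwards [leftMul_ae (c • z) (smulVec μ w f), smulVec_ae w f,
    smulVec_ae (z * w) (leftMul μ ℂ c f), leftMul_ae c f] with x h1 h2 h3 h4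
  rw [h1, h2, h3, h4, smul_mul_smul_comm]

/-- Scalars commute with `A`, so the factors `z` and `w` leave the integral as `z * w`; this is
multiplicativity on elementary tensors. -/
theorem conv_smulVec [CompleteSpace A] (z w : A) (f g : Lp ℂ 1 μ) :
    conv (smulVec μ z f) (smulVec μ w g) = smulVec μ (z * w) (conv f g) := by
  rw [conv, conv, ← (smulVec μ (z * w)).integral_comp_comm (integrable_conv' f g)]
  refine integral_congr_ae ?_
  filter_upwards [smulVec_ae z f] with y hy
  rw [hy, translate_smulVec, leftMul_smulVec]

end GroupAlg

/-- For an [IN] group `G` and a Banach algebra `A` with a bounded `Z(A)`-approximate identity,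
`f ⊗ a ↦ f(·) a` extends to an isometric algebra isomorphism of `Z(L¹(G)) ⊗^γ Z(A)` onto
`Z(L¹(G, A))`. -/
theorem mainTheorem2 {G : Type*} [Group G] [TopologicalSpace G] [IsTopologicalGroup G]
    [LocallyCompactSpace G] [T2Space G] [MeasurableSpace G] [BorelSpace G]
    (μ : Measure G) [μ.IsHaarMeasure] [μ.Regular] (hG : IsINGroup G)
    {A : Type*} [NonUnitalNormedRing A] [NormedSpace ℂ A] [IsScalarTower ℂ A A]
    [SMulCommClass ℂ A A] [CompleteSpace A]
    {ι : Type*} [Preorder ι] [IsDirectedOrder ι] [Nonempty ι] (a : ι → A)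
    (ha : IsBoundedCenterApproxIdentity a) :
    ∃ Φ : ProjTensor (NonUnitalSubalgebra.center ℂ (GroupAlg μ ℂ)) (NonUnitalSubalgebra.center ℂ A)
        ≃ₗᵢ[ℂ] NonUnitalSubalgebra.center ℂ (GroupAlg μ A),
      (∀ u v, Φ (u * v) = Φ u * Φ v) ∧
      ∀ (f : NonUnitalSubalgebra.center ℂ (GroupAlg μ ℂ)) (z : NonUnitalSubalgebra.center ℂ A),
        ⇑(Φ (ProjTensor.tmul f z) : GroupAlg μ A).toLp =ᵐ[μ]
          fun x => (f : GroupAlg μ ℂ).toLp x • (z : A) := by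
  have : μ.IsMulRightInvariant := hG.isMulRightInvariant μ
  -- For `A = ℂ` the constant net `1` is an approximate identity and the centre is everything. The
  -- target is `L¹` of the same trimmed measure as for `A`.
  obtain ⟨e₁, he₁⟩ := GroupAlg.exists_center_equiv (μ := μ) (A := ℂ) (a := fun _ : Unit => (1 : ℂ))
    ⟨⟨1, fun _ => norm_one.le⟩, fun z _ => by simp⟩ LinearIsometry.id
    (fun z => ⟨fun _ => ⟨z, rfl⟩,
      fun _ => NonUnitalSubalgebra.mem_center_iff_forall_mul.2 fun a => mul_comm a z⟩)
  obtain ⟨e, he⟩ := GroupAlg.exists_center_equiv (μ := μ) ha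
    (E := NonUnitalSubalgebra.center ℂ A)
    { toFun := Subtype.val
      map_add' := fun _ _ => rfl
      map_smul' := fun _ _ => rfl
      norm_map' := fun _ => rfl }
    (fun z => ⟨fun hz => ⟨⟨z, hz⟩, rfl⟩, fun ⟨w, hw⟩ => hw ▸ w.2⟩)
  have : CompleteSpace (NonUnitalSubalgebra.center ℂ A) :=
    NonUnitalSubalgebra.isClosed_center.completeSpace_coe
  obtain ⟨Θ, hΘ⟩ := ProjTensor.exists_linearIsometryEquiv_L1
    (E := NonUnitalSubalgebra.center ℂ A) e₁
  let Φ : ProjTensor (NonUnitalSubalgebra.center ℂ (GroupAlg μ ℂ)) (NonUnitalSubalgebra.center ℂ A)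
        ≃ₗᵢ[ℂ] NonUnitalSubalgebra.center ℂ (GroupAlg μ A) := Θ.trans e.symm
  have hΦ : ∀ (f : NonUnitalSubalgebra.center ℂ (GroupAlg μ ℂ)) (z : NonUnitalSubalgebra.center ℂ A),
      ⇑(Φ (ProjTensor.tmul f z) : GroupAlg μ A).toLp =ᵐ[μ]
        fun x => (f : GroupAlg μ ℂ).toLp x • (z : A) := fun f z => by
    have h1 := he (Φ (ProjTensor.tmul f z))
    -- In `L¹(ν, Z(A))` the image of `f ⊗ z` is `e₁ f` times `z`; equality almost everywhere for `ν`
    -- implies it for `μ`.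
    rw [show e (Φ (ProjTensor.tmul f z)) = Θ (ProjTensor.tmul f z) from e.apply_symm_apply _] at h1
    filter_upwards [h1, he₁ f, ae_eq_of_ae_eq_trim (hΘ f z)] with x h1 h2 h3
    rw [h1, h2, h3]
    rfl
  have hΦ' : ∀ (f : NonUnitalSubalgebra.center ℂ (GroupAlg μ ℂ))
      (z : NonUnitalSubalgebra.center ℂ A),
      (Φ (ProjTensor.tmul f z) : GroupAlg μ A).toLp =
        GroupAlg.smulVec μ (z : A) (f : GroupAlg μ ℂ).toLp := fun f z =>
    Lp.ext ((hΦ f z).trans (GroupAlg.smulVec_ae _ _).symm)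
  refine ⟨Φ, fun u v => ?_, hΦ⟩
  refine ProjTensor.map_mul_of_tmul Φ.continuous (map_zero Φ) (map_add Φ) (fun f g z w => ?_) u v
  rw [ProjTensor.tmul_mul_tmul]
  refine Subtype.ext ((hΦ' (f * g) (z * w)).trans ?_)
  change _ = GroupAlg.conv (Φ (ProjTensor.tmul f z) : GroupAlg μ A).toLp
    (Φ (ProjTensor.tmul g w) : GroupAlg μ A).toLp
  rw [hΦ', hΦ', GroupAlg.conv_smulVec]
  rfl
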